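/- A valuation distribution is a Borel probability measure $\mathcal D$ on $\mathbb R_+=[0,\infty)$. The revenue of a price $p\in\mathbb R_+$ is $\mathrm{rev}_{\mathcal D}(p)=p\cdot\Pr_{v\sim\mathcal D}[v\ge p]$, and the optimal revenue is $\mathrm{opt}_{\mathcal D}=\sup_{p\in\mathbb R_+}\mathrm{rev}_{\mathcal D}(p)$. A learning algorithm is a sequence $(t_n)_{n\in\mathbb N}$ of (possibly randomized, measurable) maps $t_n:\mathbb R_+^n\to\mathbb R_+$ from samples to prices, and its revenue gap is $\epsilon_n(t_n,\mathcal D)=\mathrm{opt}_{\mathcal D}-\mathbb E[\mathrm{rev}_{\mathcal D}(t_n(S))]$, where the expectation is over $S\sim\mathcal D^n$ and the internal randomness of the algorithm. For a function $g:\mathbb N\to\mathbb N$, a capped empirical revenue maximization (capped ERM) with cap $g$ is an algorithm that on every sample $S$ of size $n$ outputs (almost surely) a price maximizing $\mathrm{rev}_{\widehat{\mathcal D}_S}$ over $[0,g(n)]$, where $\widehat{\mathcal D}_S$ is the empirical distribution of $S$ and ties are broken arbitrarily. A rate is a function $R:\mathbb N\to(0,\infty)$, and $R(x)$ means $R(\lfloor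 x\rfloor)$ for real $x\ge 0$. Theorem. Let $\mathbb D$ be the class of valuation distributions $\mathcal D$ such that $\mathrm{opt}_{\mathcal D}<\infty$ and $\mathrm{opt}_{\mathcal D}=\mathrm{rev}_{\mathcal D}(p^*)$ for some finite price $p^*$. 1. Let $R$ be a rate with $R\in\omega(n^{-1/2})$, i.e. $\lim_{n\to\infty}R(n)\sqrt n=\infty$. Then there is a non-decreasing function $g:\mathbb N\to\mathbb N$, depending only on $R$, with $g(n)\to\infty$ and $g(n)/\sqrt n\le R(n)$ for all sufficiently large $n$, such that capped ERM algorithms with cap $g$ exist and every such algorithm $(t_n)$ learns $\mathbb D$ universally at rate $R$: for every $\mathcal D\in\mathbb D$ there are constants $C,c>0$ with $\epsilon_n(t_n,\mathcal D)\le C\,R(cn)$ for all $n$. In particular, $\mathbb D$ is universally learnable at rate $R$. 2. Conversely, let $R$ be a rate with $R\in o(n^{-1/2})$, i.e. $\lim_{n\to\infty}R(n)\sqrt n=0$. Then $\mathbb D$ is not universally learnable at a rate faster than $R$: for every algorithm $(t_n)$ there are one fixed distribution $\mathcal D\in\mathbb D$, supported in $[0,1]$, and constants $C,c>0$ such that $\epsilon_n(t_n,\mathcal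 D)\ge C\,R(cn)$ for infinitely many $n$. -/

import Mathlib

open MeasureTheory ProbabilityTheory Filter Topology
open scoped NNReal ENNReal

noncomputable section

/-- A valuation distribution: a Borel probability measure on `[0, ∞)`. -/
abbrev ValuationDistribution : Type := ProbabilityMeasure ℝ≥0

/-- The revenue `p * Pr[v ≥ p]` of the posted price `p` when the valuation `v` has law `μ`
(that is, `p * (1 - F p)` with `F p = Pr[v < p]`). -/
def revenue (μ : Measure ℝ≥0) (p : ℝ≥0) : ℝ≥0∞ :=
  (p : ℝ≥0∞) * μ (Set.Ici p)

/-- The optimal revenue, possibly infinite: the supremum of the revenue over all finite prices. -/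
def optRevenue (D : ValuationDistribution) : ℝ≥0∞ :=
  ⨆ p : ℝ≥0, revenue (D : Measure ℝ≥0) p

/-- The class of distributions with finite optimal revenue that is attained at a finite price. -/
def attainedClass : Set ValuationDistribution :=
  {D | optRevenue D < ∞ ∧ ∃ p : ℝ≥0, revenue (D : Measure ℝ≥0) p = optRevenue D}

/-- A (possibly randomized) learning algorithm: for every sample size `n`, a Markov kernel that
sends a sample in `[0, ∞)^n` to the law of the price the algorithm outputs on this sample. -/
structure PricingAlgorithm where
  kernel : ∀ n : ℕ, Kernel (Fin n → ℝ≥0) ℝ≥0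
  isMarkovKernel : ∀ n : ℕ, IsMarkovKernel (kernel n)

/-- The expected revenue of an algorithm on `n` i.i.d. samples from `D`; the expectation is over the
sample and the internal randomness of the algorithm. -/
def expectedRevenue (t : PricingAlgorithm) (D : ValuationDistribution) (n : ℕ) : ℝ≥0∞ :=
  ∫⁻ s, ∫⁻ p, revenue (D : Measure ℝ≥0) p ∂(t.kernel n s)
    ∂(Measure.pi fun _ : Fin n => (D : Measure ℝ≥0))

/-- The learning curve: the expected revenue gap at sample size `n`. It is only used for
distributions of finite optimal revenue, where both terms are finite. -/
def revenueGap (t : PricingAlgorithm) (D : ValuationDistribution) (n : ℕ) : ℝ :=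
  (optRevenue D).toReal - (expectedRevenue t D n).toReal

/-- The algorithm `t` learns the class `𝔻` universally at rate `R`: the constants may depend on the
distribution. Since `R` is a function on `ℕ`, `R (c n)` is read as `R ⌊c n⌋`. -/
def LearnsUniversallyAtRate (t : PricingAlgorithm) (𝔻 : Set ValuationDistribution)
    (R : ℕ → ℝ) : Prop :=
  ∀ D ∈ 𝔻, ∃ C > (0 : ℝ), ∃ c > (0 : ℝ), ∀ n : ℕ, revenueGap t D n ≤ C * R ⌊c * (n : ℝ)⌋₊

/-- The class `𝔻` is not universally learnable at a rate faster than `R`: for every algorithm there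
is one fixed distribution in `𝔻` on which the gap is at least `C * R (c n)` infinitely often. -/
def NotUniversallyLearnableFasterThan (𝔻 : Set ValuationDistribution) (R : ℕ → ℝ) : Prop :=
  ∀ t : PricingAlgorithm, ∃ D ∈ 𝔻, ∃ C > (0 : ℝ), ∃ c > (0 : ℝ),
    ∃ᶠ n : ℕ in atTop, C * R ⌊c * (n : ℝ)⌋₊ ≤ revenueGap t D n

/-- The empirical distribution of a sample. -/
def empiricalDistribution {n : ℕ} (s : Fin n → ℝ≥0) : Measure ℝ≥0 :=
  (n : ℝ≥0∞)⁻¹ • ∑ i, Measure.dirac (s i)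

/-- `t` is a capped empirical revenue maximization with cap `g`: on every sample of size `n` its
output (almost surely in its internal randomness) maximizes the revenue under the empirical
distribution over the prices in `[0, g n]`. Ties are broken arbitrarily, possibly at random. -/
def IsCappedERM (g : ℕ → ℕ) (t : PricingAlgorithm) : Prop :=
  ∀ (n : ℕ) (s : Fin n → ℝ≥0), ∀ᵐ p ∂(t.kernel n s),
    p ≤ (g n : ℝ≥0) ∧
      ∀ q : ℝ≥0, q ≤ (g n : ℝ≥0) →
        revenue (empiricalDistribution s) q ≤ revenue (empiricalDistribution s) p

end

/-! Upper bound. Once `g n` exceeds an optimal price, the cap costs nothing. Replacing the true law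
by the empirical one changes the revenue of a price `p ≤ g n` by at most `g n` times the uniform
deviation of the tails, so a capped empirical maximizer loses at most twice this amount. The
expected uniform deviation is at most `4 / √n`: symmetrization with a ghost sample reduces it to
Rademacher sums over upper level sets, and after sorting the sample these are partial sums of a
simple random walk, controlled by Doob's inequality. The loss is thus at most `8 * g n / √n`.

Lower bound. A two-point argument gives a hard law for each `n`; here one law must be hard for
infinitely many `n`. Start from a law whose revenue curve has a plateau at height `M`. Raising the
revenue to `M + R n` inside one half of the plateau multiplies the density by `1 + O(R n)`, which
`n` samples hardly detect when `n * R n ^ 2` is small. The halves are disjoint, so the algorithm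
misses one of them with probability at least `1/2` before the change, and at least `1/4` after it
(`IsFlat.exists_next`).

The raised piece contains a new plateau, on which the construction is repeated with a larger `n`. It
is made so narrow that `n` samples hit it `1/8` times in expectation at most. All later changes live
inside it, so they cost the earlier stage at most `1/8` in probability. The limit law
(`exists_limit_measure`) therefore still has gap at least `R n / 8` at every stage. -/

/-! ### Maximal inequality for the simple random walk -/

/-- The sign attached to a Boolean. -/
def boolSign (b : Bool) : ℝ := if b then 1 else -1

/-- The maximum of `m` and of the absolute values of the partial sums of the signed steps `ε`,
started at `x`. -/
def walkMax : (n : ℕ) → (Fin n → Bool) → ℝ → ℝ → ℝ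
  | 0, _, _, m => m
  | n + 1, ε, x, m =>
    walkMax n (Fin.tail ε) (x + boolSign (ε 0)) (max m |x + boolSign (ε 0)|)

lemma le_walkMax (n : ℕ) (ε : Fin n → Bool) (x m : ℝ) : m ≤ walkMax n ε x m := by
  induction n generalizing x m with
  | zero => exact le_rfl
  | succ n ih => exact (le_max_left _ _).trans (ih _ _ _)

/-- A downward closed `p` selects an initial segment of the indices, so the sum is one of the
partial sums of the walk. -/
lemma abs_add_sum_antitone_le_walkMax (n : ℕ) (ε : Fin n → Bool) (x m : ℝ) (hx : |x| ≤ m)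
    (p : Fin n → Prop) [DecidablePred p] (hp : ∀ i j, i ≤ j → p j → p i) :
    |x + ∑ i, boolSign (ε i) * (if p i then 1 else 0)| ≤ walkMax n ε x m := by
  induction n generalizing x m with
  | zero => simpa [walkMax] using hx
  | succ n ih =>
    rw [Fin.sum_univ_succ]
    by_cases h0 : p 0
    · have := ih (Fin.tail ε) (x + boolSign (ε 0)) (max m |x + boolSign (ε 0)|)
        (le_max_right _ _) (fun i => p i.succ)
        (fun i j hij h => hp _ _ (Fin.succ_le_succ_iff.2 hij) h)
      simpa [h0, walkMax, Fin.tail, add_assoc] using this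
    · have h1 : ∀ i : Fin n, ¬ p i.succ := fun i h => h0 (hp _ _ (Fin.zero_le _) h)
      simpa [h0, h1] using hx.trans (le_walkMax _ _ _ _)

/-- Doob's `L²` maximal inequality for the simple random walk, with its Burkholder potential. -/
lemma sum_walkMax_sq_le (n : ℕ) (x m : ℝ) (hx : |x| ≤ m) :
    ∑ ε : Fin n → Bool, walkMax n ε x m ^ 2 ≤
      2 ^ n * (4 * (x ^ 2 + n) + 2 * m ^ 2 - 4 * m * |x|) := by
  induction n generalizing x m with
  | zero =>
    simp only [walkMax, Finset.univ_unique, Finset.sum_const, Finset.card_singleton, one_smul,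
      pow_zero, one_mul, Nat.cast_zero, add_zero]
    nlinarith [sq_nonneg (m - 2 * |x|), sq_abs x]
  | succ n ih =>
    -- Updating the running maximum does not increase the potential: when `|y|` exceeds `m`, the
    -- drop is `2 * (m - |y|) ^ 2`.
    have key : ∀ y : ℝ, 2 * (max m |y|) ^ 2 - 4 * max m |y| * |y| ≤ 2 * m ^ 2 - 4 * m * |y| := by
      intro y
      rcases le_total m |y| with h | h
      · rw [max_eq_right h]; nlinarith [sq_nonneg (m - |y|)]
      · rw [max_eq_left h]
    have hs : ∑ ε : Fin (n + 1) → Bool, walkMax (n + 1) ε x m ^ 2 =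
        ∑ b : Bool, ∑ ε : Fin n → Bool,
          walkMax n ε (x + boolSign b) (max m |x + boolSign b|) ^ 2 := by
      rw [← (Fin.consEquiv (fun _ : Fin (n + 1) => Bool)).sum_comp, Fintype.sum_prod_type]
      simp [walkMax, Fin.consEquiv]
    have hm : 0 ≤ m := (abs_nonneg x).trans hx
    have h1 := ih (x + 1) (max m |x + 1|) (le_max_right _ _)
    have h2 := ih (x + -1) (max m |x + -1|) (le_max_right _ _)
    have h3 := key (x + 1)
    have h4 := key (x + -1)
    -- Convexity of `|·|` makes the term `-4 * m * |x|` decrease on average, while the growth of `x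
    -- ^ 2` by `1` on average is what turns `n` into `n + 1`.
    have h5 : 2 * |x| ≤ |x + 1| + |x + -1| := by
      have := abs_add_le (x + 1) (x + -1)
      rw [show x + 1 + (x + -1) = 2 * x by ring, abs_mul, abs_two] at this
      exact this
    rw [hs, Fintype.sum_bool]
    simp only [boolSign, if_true, Bool.false_eq_true, if_false]
    have h2n : (0 : ℝ) < 2 ^ n := by positivity
    refine (add_le_add h1 h2).trans ?_
    rw [← mul_add, pow_succ (2 : ℝ) n, mul_assoc ((2 : ℝ) ^ n)]
    refine mul_le_mul_of_nonneg_left ?_ h2n.le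
    push_cast
    nlinarith [mul_le_mul_of_nonneg_left h5 hm]

lemma sum_walkMax_le (n : ℕ) (hn : 0 < n) :
    ∑ ε : Fin n → Bool, walkMax n ε 0 0 ≤ 2 ^ n * (2 * √n) := by
  have h := sum_walkMax_sq_le n 0 0 (by simp)
  have hs : 0 < √(n : ℝ) := Real.sqrt_pos.2 (by exact_mod_cast hn)
  have hsq : √(n : ℝ) ^ 2 = n := Real.sq_sqrt (by positivity)
  -- AM-GM with weight `2 * √n` replaces Cauchy–Schwarz in passing from the second moment to the
  -- first.
  have h1 : ∀ ε : Fin n → Bool, 4 * √(n : ℝ) * walkMax n ε 0 0 ≤ walkMax n ε 0 0 ^ 2 + 4 * n := by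
    intro ε
    nlinarith [sq_nonneg (walkMax n ε 0 0 - 2 * √(n : ℝ))]
  have h2 := Finset.sum_le_sum (fun ε (_ : ε ∈ Finset.univ) => h1 ε)
  rw [← Finset.mul_sum, Finset.sum_add_distrib] at h2
  simp only [Finset.sum_const, Finset.card_univ, Fintype.card_fun, Fintype.card_bool,
    Fintype.card_fin, nsmul_eq_mul] at h2
  push_cast at h2
  have h3 : 4 * √(n : ℝ) * ∑ ε : Fin n → Bool, walkMax n ε 0 0 ≤
      4 * √(n : ℝ) * (2 ^ n * (2 * √n)) := by
    calc _ ≤ _ := h2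
      _ ≤ 2 ^ n * (4 * n) + 2 ^ n * (4 * n) := by
        gcongr
        simpa using h
      _ = 2 ^ n * 8 * √(n : ℝ) ^ 2 := by rw [hsq]; ring
      _ = _ := by ring
  exact le_of_mul_le_mul_left h3 (by positivity)

/-! ### Symmetrization and the expected Kolmogorov distance -/

/-- The indicator of the event `q ≤ x`, as a real number. -/
noncomputable def upperIndicator (q x : ℝ≥0) : ℝ := if q ≤ x then 1 else 0

/-- Maximal inequality for Rademacher sums over upper level sets of a sample. -/
lemma sum_iSup_enorm_signed_le {ι : Type*} (T : ι → ℝ≥0) (n : ℕ) (hn : 0 < n) (s : Fin n → ℝ≥0) :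
    ∑ ε : Fin n → Bool, ⨆ q : ι, ‖∑ i, boolSign (ε i) * upperIndicator (T q) (s i)‖ₑ ≤
      ENNReal.ofReal (2 ^ n * (2 * √n)) := by
  -- In decreasing order of the sample, every upper level set is an initial segment; permuting the
  -- signs only reindexes the sum over `ε`.
  obtain ⟨σ, hσ⟩ : ∃ σ : Equiv.Perm (Fin n), Antitone (s ∘ σ) :=
    ⟨Tuple.sort (OrderDual.toDual ∘ s), Tuple.monotone_sort (OrderDual.toDual ∘ s)⟩
  have h1 : ∀ ε : Fin n → Bool,
      ⨆ q : ι, ‖∑ i, boolSign (ε i) * upperIndicator (T q) (s i)‖ₑ ≤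
        ENNReal.ofReal (walkMax n (ε ∘ σ) 0 0) := by
    intro ε
    refine iSup_le fun q => ?_
    rw [← ofReal_norm, Real.norm_eq_abs]
    refine ENNReal.ofReal_le_ofReal ?_
    rw [← Equiv.sum_comp σ]
    have := abs_add_sum_antitone_le_walkMax n (ε ∘ σ) 0 0 (by simp) (fun i => T q ≤ s (σ i))
      (fun i j hij h => h.trans (hσ hij))
    simpa [upperIndicator] using this
  refine (Finset.sum_le_sum fun ε _ => h1 ε).trans ?_
  rw [← ENNReal.ofReal_sum_of_nonneg (fun ε _ => le_walkMax n _ 0 0)]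
  refine ENNReal.ofReal_le_ofReal ?_
  refine le_trans (le_of_eq ?_) (sum_walkMax_le n hn)
  exact (Equiv.arrowCongr σ (Equiv.refl Bool)).symm.sum_comp (fun ε => walkMax n ε 0 0)

lemma measurable_upperIndicator (q : ℝ≥0) : Measurable (upperIndicator q) :=
  Measurable.ite measurableSet_Ici measurable_const measurable_const

lemma upperIndicator_eq_indicator (q : ℝ≥0) :
    upperIndicator q = (Set.Ici q).indicator (fun _ => (1 : ℝ)) := by
  ext x
  simp [upperIndicator, Set.indicator_apply]

lemma integrable_upperIndicator (μ : Measure ℝ≥0) [IsProbabilityMeasure μ] (q : ℝ≥0) :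
    Integrable (upperIndicator q) μ := by
  rw [upperIndicator_eq_indicator]
  exact (integrable_const _).indicator measurableSet_Ici

lemma integral_upperIndicator (μ : Measure ℝ≥0) [IsProbabilityMeasure μ] (q : ℝ≥0) :
    ∫ x, upperIndicator q x ∂μ = μ.real (Set.Ici q) := by
  rw [upperIndicator_eq_indicator, integral_indicator measurableSet_Ici]
  simp

section Symmetrization

variable {ι : Type*} [Countable ι] (T : ι → ℝ≥0) (n : ℕ) (μ : Measure ℝ≥0)
  [IsProbabilityMeasure μ]

lemma measurable_iSup_signed (ε : Fin n → Bool) : Measurable fun s : Fin n → ℝ≥0 =>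
    ⨆ q : ι, ‖∑ i, boolSign (ε i) * upperIndicator (T q) (s i)‖ₑ := by
  refine Measurable.iSup fun q => Measurable.enorm ?_
  refine Finset.measurable_sum _ fun i _ => Measurable.const_mul ?_ _
  exact (measurable_upperIndicator _).comp (measurable_pi_apply i)

lemma measurable_iSup_signed_sub (ε : Fin n → Bool) : Measurable fun z : Fin n → ℝ≥0 × ℝ≥0 =>
    ⨆ q : ι, ‖∑ i, boolSign (ε i) *
      (upperIndicator (T q) (z i).1 - upperIndicator (T q) (z i).2)‖ₑ := by
  refine Measurable.iSup fun q => Measurable.enorm ?_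
  refine Finset.measurable_sum _ fun i _ => Measurable.const_mul ?_ _
  exact ((measurable_upperIndicator _).comp (measurable_fst.comp (measurable_pi_apply i))).sub
    ((measurable_upperIndicator _).comp (measurable_snd.comp (measurable_pi_apply i)))

/-- Flipping the sign of a difference amounts to swapping the two points of that pair, which
preserves `μ.prod μ`. -/
lemma lintegral_signed_sub_eq (ε : Fin n → Bool) :
    ∫⁻ z : Fin n → ℝ≥0 × ℝ≥0, ⨆ q : ι, ‖∑ i, boolSign (ε i) *
        (upperIndicator (T q) (z i).1 - upperIndicator (T q) (z i).2)‖ₑ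
      ∂(Measure.pi fun _ => μ.prod μ) =
    ∫⁻ z : Fin n → ℝ≥0 × ℝ≥0, ⨆ q : ι, ‖∑ i,
        (upperIndicator (T q) (z i).1 - upperIndicator (T q) (z i).2)‖ₑ
      ∂(Measure.pi fun _ => μ.prod μ) := by
  have hmp : MeasurePreserving
      (fun (z : Fin n → ℝ≥0 × ℝ≥0) i => (if ε i then id else Prod.swap) (z i))
      (Measure.pi fun _ => μ.prod μ) (Measure.pi fun _ => μ.prod μ) := by
    refine measurePreserving_pi _ _ fun i => ?_
    cases ε i
    · simpa using Measure.measurePreserving_swap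
    · simpa using MeasurePreserving.id _
  have hm := measurable_iSup_signed_sub T n (fun _ => true)
  simp only [boolSign, if_true, one_mul] at hm
  rw [← hmp.lintegral_comp hm]
  refine lintegral_congr fun z => ?_
  refine iSup_congr fun q => congrArg _ (Finset.sum_congr rfl fun i _ => ?_)
  cases h : ε i <;> simp [boolSign, h]

lemma lintegral_pi_prod_fst {f : (Fin n → ℝ≥0) → ℝ≥0∞} (hf : Measurable f) :
    ∫⁻ z : Fin n → ℝ≥0 × ℝ≥0, f (fun i => (z i).1) ∂(Measure.pi fun _ => μ.prod μ) =
      ∫⁻ s, f s ∂(Measure.pi fun _ => μ) :=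
  (measurePreserving_pi (fun _ : Fin n => μ.prod μ) (fun _ => μ)
    (fun _ => measurePreserving_fst)).lintegral_comp hf

lemma lintegral_pi_prod_snd {f : (Fin n → ℝ≥0) → ℝ≥0∞} (hf : Measurable f) :
    ∫⁻ z : Fin n → ℝ≥0 × ℝ≥0, f (fun i => (z i).2) ∂(Measure.pi fun _ => μ.prod μ) =
      ∫⁻ s, f s ∂(Measure.pi fun _ => μ) :=
  (measurePreserving_pi (fun _ : Fin n => μ.prod μ) (fun _ => μ)
    (fun _ => measurePreserving_snd)).lintegral_comp hf

lemma lintegral_signed_sub_le (ε : Fin n → Bool) :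
    ∫⁻ z : Fin n → ℝ≥0 × ℝ≥0, ⨆ q : ι, ‖∑ i, boolSign (ε i) *
        (upperIndicator (T q) (z i).1 - upperIndicator (T q) (z i).2)‖ₑ
      ∂(Measure.pi fun _ => μ.prod μ) ≤
    2 * ∫⁻ s, ⨆ q : ι, ‖∑ i, boolSign (ε i) * upperIndicator (T q) (s i)‖ₑ
      ∂(Measure.pi fun _ => μ) := by
  have hm := measurable_iSup_signed T n ε
  have hm1 : Measurable fun z : Fin n → ℝ≥0 × ℝ≥0 =>
      ⨆ q : ι, ‖∑ i, boolSign (ε i) * upperIndicator (T q) (z i).1‖ₑ :=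
    hm.comp (measurable_pi_lambda _ fun i => measurable_fst.comp (measurable_pi_apply i))
  rw [two_mul]
  nth_rw 1 [← lintegral_pi_prod_fst n μ hm]
  rw [← lintegral_pi_prod_snd n μ hm,
    ← lintegral_add_left hm1]
  refine lintegral_mono fun z => iSup_le fun q => ?_
  simp only [mul_sub, Finset.sum_sub_distrib]
  refine enorm_sub_le.trans (add_le_add ?_ ?_)
  · exact le_iSup (fun q => ‖∑ i, boolSign (ε i) * upperIndicator (T q) (z i).1‖ₑ) q
  · exact le_iSup (fun q => ‖∑ i, boolSign (ε i) * upperIndicator (T q) (z i).2‖ₑ) q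

/-- All `2 ^ n` signed versions have the same integral, so it may be averaged over the signs; for
each fixed sample the sign average is then bounded by the walk inequality. -/
lemma lintegral_iSup_sub_le (hn : 0 < n) :
    ∫⁻ z : Fin n → ℝ≥0 × ℝ≥0, ⨆ q : ι, ‖∑ i,
        (upperIndicator (T q) (z i).1 - upperIndicator (T q) (z i).2)‖ₑ
      ∂(Measure.pi fun _ => μ.prod μ) ≤ ENNReal.ofReal (4 * √n) := by
  set E := ∫⁻ z : Fin n → ℝ≥0 × ℝ≥0, ⨆ q : ι, ‖∑ i,
        (upperIndicator (T q) (z i).1 - upperIndicator (T q) (z i).2)‖ₑ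
      ∂(Measure.pi fun _ => μ.prod μ) with hE
  have h1 : (2 : ℝ≥0∞) ^ n * E ≤ 2 ^ n * ENNReal.ofReal (4 * √n) := by
    calc (2 : ℝ≥0∞) ^ n * E = ∑ _ε : Fin n → Bool, E := by simp
      _ ≤ ∑ ε : Fin n → Bool, 2 * ∫⁻ s, ⨆ q : ι,
            ‖∑ i, boolSign (ε i) * upperIndicator (T q) (s i)‖ₑ ∂(Measure.pi fun _ => μ) := by
          refine Finset.sum_le_sum fun ε _ => ?_
          rw [hE, ← lintegral_signed_sub_eq T n μ ε]
          exact lintegral_signed_sub_le T n μ ε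
      _ = 2 * ∫⁻ s, ∑ ε : Fin n → Bool, ⨆ q : ι,
            ‖∑ i, boolSign (ε i) * upperIndicator (T q) (s i)‖ₑ ∂(Measure.pi fun _ => μ) := by
          rw [← Finset.mul_sum, lintegral_finsetSum _ fun ε _ => measurable_iSup_signed T n ε]
      _ ≤ 2 * ∫⁻ _s, ENNReal.ofReal (2 ^ n * (2 * √n)) ∂(Measure.pi fun _ : Fin n => μ) := by
          gcongr with s
          exact sum_iSup_enorm_signed_le T n hn s
      _ = 2 ^ n * ENNReal.ofReal (4 * √n) := by
          have h2 : (2 : ℝ≥0∞) = ENNReal.ofReal 2 := by simp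
          rw [lintegral_const, measure_univ, mul_one, h2, ← ENNReal.ofReal_pow (by norm_num),
            ← ENNReal.ofReal_mul (by norm_num), ← ENNReal.ofReal_mul (by positivity)]
          ring_nf
  exact (ENNReal.mul_le_mul_iff_right (by simp) (by simp)).1 h1

/-- The expected Kolmogorov distance between the counting function of an i.i.d. sample and its
mean is of order `√n`. -/
lemma lintegral_iSup_count_sub_le (hn : 0 < n) :
    ∫⁻ s : Fin n → ℝ≥0, ⨆ q : ι,
        ‖∑ i, (upperIndicator (T q) (s i) - μ.real (Set.Ici (T q)))‖ₑ
      ∂(Measure.pi fun _ => μ) ≤ ENNReal.ofReal (4 * √n) := by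
  refine le_trans ?_ (lintegral_iSup_sub_le T n μ hn)
  have hm := measurable_iSup_signed_sub T n (fun _ => true)
  simp only [boolSign, if_true, one_mul] at hm
  have hmp := (measurePreserving_arrowProdEquivProdArrow ℝ≥0 ℝ≥0 (Fin n)
    (fun _ => μ) (fun _ => μ)).symm
  rw [← hmp.lintegral_comp hm, lintegral_prod]
  swap
  · exact (hm.comp hmp.measurable).aemeasurable
  refine lintegral_mono fun s => iSup_le fun q => ?_
  -- The mean is the expectation over an independent ghost sample `s'`, so Jensen bounds the
  -- centered sum by the expected difference of two samples.
  have h1 : ∑ i, (upperIndicator (T q) (s i) - μ.real (Set.Ici (T q))) =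
      ∫ s' : Fin n → ℝ≥0, ∑ i, (upperIndicator (T q) (s i) - upperIndicator (T q) (s' i))
        ∂(Measure.pi fun _ => μ) := by
    have hi : ∀ i : Fin n, Integrable (fun s' : Fin n → ℝ≥0 => upperIndicator (T q) (s' i))
        (Measure.pi fun _ => μ) := fun i =>
      (measurePreserving_eval (fun _ : Fin n => μ) i).integrable_comp_of_integrable
        (integrable_upperIndicator μ (T q))
    have hi' : ∀ i : Fin n, Integrable (fun s' : Fin n → ℝ≥0 =>
        upperIndicator (T q) (s i) - upperIndicator (T q) (s' i)) (Measure.pi fun _ => μ) :=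
      fun i => (integrable_const _).sub (hi i)
    rw [integral_finsetSum _ fun i _ => hi' i]
    refine Finset.sum_congr rfl fun i _ => ?_
    rw [integral_sub (integrable_const _) (hi i), integral_const, probReal_univ, one_smul,
      ← integral_upperIndicator μ]
    have := integral_map (μ := Measure.pi fun _ : Fin n => μ) (measurable_pi_apply i).aemeasurable
      (measurable_upperIndicator (T q)).aestronglyMeasurable
    rw [← this, (measurePreserving_eval (fun _ : Fin n => μ) i).map_eq]
  rw [h1]
  refine (enorm_integral_le_lintegral_enorm _).trans (lintegral_mono fun s' => ?_)
  exact le_iSup (fun q => ‖∑ i, (upperIndicator (T q) (s i) - upperIndicator (T q) (s' i))‖ₑ) q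

end Symmetrization

/-! ### From countably many thresholds to all prices -/

lemma tendsto_upperIndicator (q x : ℝ≥0) :
    Tendsto (fun q' => upperIndicator q' x) (𝓝[≤] q) (𝓝 (upperIndicator q x)) := by
  refine tendsto_const_nhds.congr' ?_
  by_cases h : q ≤ x
  · filter_upwards [self_mem_nhdsWithin] with q' hq'
    have : q' ≤ x := le_trans hq' h
    simp [upperIndicator, h, this]
  · filter_upwards [mem_nhdsWithin_of_mem_nhds (Ioi_mem_nhds (not_le.1 h))] with q' hq'
    have : ¬ q' ≤ x := not_le.2 hq'
    simp [upperIndicator, h, this]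

lemma norm_upperIndicator_le (q x : ℝ≥0) : ‖upperIndicator q x‖ ≤ 1 := by
  unfold upperIndicator
  split_ifs <;> simp

/-- The tail of a probability measure is left continuous. -/
lemma tendsto_measureReal_Ici (μ : Measure ℝ≥0) [IsProbabilityMeasure μ] (q : ℝ≥0) :
    Tendsto (fun q' => μ.real (Set.Ici q')) (𝓝[≤] q) (𝓝 (μ.real (Set.Ici q))) := by
  simp only [← integral_upperIndicator μ]
  refine tendsto_integral_filter_of_dominated_convergence (fun _ => (1 : ℝ)) ?_ ?_
    (integrable_const _) ?_
  · exact Eventually.of_forall fun q' => (measurable_upperIndicator q').aestronglyMeasurable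
  · exact Eventually.of_forall fun q' => Eventually.of_forall (norm_upperIndicator_le q')
  · exact Eventually.of_forall (tendsto_upperIndicator q)

/-- The uniform deviation between the counting function of a sample and `n` times the tail. -/
noncomputable def tailDeviation (μ : Measure ℝ≥0) {n : ℕ} (s : Fin n → ℝ≥0) : ℝ≥0∞ :=
  ⨆ k : ℕ, ‖∑ i, (upperIndicator (TopologicalSpace.denseSeq ℝ≥0 k) (s i) -
    μ.real (Set.Ici (TopologicalSpace.denseSeq ℝ≥0 k)))‖ₑ

lemma measurable_tailDeviation (μ : Measure ℝ≥0) (n : ℕ) :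
    Measurable fun s : Fin n → ℝ≥0 => tailDeviation μ s := by
  refine Measurable.iSup fun q => Measurable.enorm ?_
  refine Finset.measurable_sum _ fun i _ => Measurable.sub_const ?_ _
  exact (measurable_upperIndicator _).comp (measurable_pi_apply i)

/-- Both tails are left continuous, so the deviation at `q` is approached along dense points to its
left. There are none for `q = 0`, where the deviation vanishes anyway. -/
lemma enorm_le_tailDeviation (μ : Measure ℝ≥0) [IsProbabilityMeasure μ] {n : ℕ}
    (s : Fin n → ℝ≥0) (q : ℝ≥0) :
    ‖∑ i, (upperIndicator q (s i) - μ.real (Set.Ici q))‖ₑ ≤ tailDeviation μ s := by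
  rcases eq_zero_or_pos q with rfl | hq
  · have : Set.Ici (0 : ℝ≥0) = Set.univ := by ext; simp
    simp [upperIndicator, this]
  have ht : Tendsto (fun q' => ‖∑ i, (upperIndicator q' (s i) - μ.real (Set.Ici q'))‖ₑ) (𝓝[≤] q)
      (𝓝 ‖∑ i, (upperIndicator q (s i) - μ.real (Set.Ici q))‖ₑ) :=
    (tendsto_finsetSum _ fun i _ =>
      (tendsto_upperIndicator q (s i)).sub (tendsto_measureReal_Ici μ q)).enorm
  by_contra! hlt
  have hev := ht.eventually (lt_mem_nhds hlt)
  obtain ⟨l, hl, hsub⟩ := (mem_nhdsLE_iff_exists_Ioc_subset' hq).1 hev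
  obtain ⟨x, ⟨k, rfl⟩, hx⟩ :=
    (TopologicalSpace.denseRange_denseSeq ℝ≥0).exists_between hl
  have := hsub ⟨hx.1, hx.2.le⟩
  exact absurd (le_iSup (fun k : ℕ => ‖∑ i, (upperIndicator (TopologicalSpace.denseSeq ℝ≥0 k) (s i)
    - μ.real (Set.Ici (TopologicalSpace.denseSeq ℝ≥0 k)))‖ₑ) k) (not_le.2 this)

/-! ### Revenue guarantee of capped empirical maximization -/

lemma empiricalDistribution_Ici {n : ℕ} (s : Fin n → ℝ≥0) (q : ℝ≥0) :
    empiricalDistribution s (Set.Ici q) =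
      (n : ℝ≥0∞)⁻¹ * ENNReal.ofReal (∑ i, upperIndicator q (s i)) := by
  rw [ENNReal.ofReal_sum_of_nonneg fun i _ => by unfold upperIndicator; split_ifs <;> simp]
  simp only [empiricalDistribution, Measure.smul_apply, Measure.finsetSum_apply, smul_eq_mul]
  congr 1
  refine Finset.sum_congr rfl fun i _ => ?_
  rw [Measure.dirac_apply' _ measurableSet_Ici, upperIndicator]
  by_cases h : q ≤ s i <;> simp [h]

lemma revenue_le_revenue_empirical (μ : Measure ℝ≥0) [IsProbabilityMeasure μ] {n : ℕ} (hn : 0 < n)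
    (s : Fin n → ℝ≥0) (q : ℝ≥0) :
    revenue μ q ≤ revenue (empiricalDistribution s) q + q * ((n : ℝ≥0∞)⁻¹ * tailDeviation μ s) ∧
    revenue (empiricalDistribution s) q ≤ revenue μ q + q * ((n : ℝ≥0∞)⁻¹ * tailDeviation μ s) := by
  have h := enorm_le_tailDeviation μ s q
  set A := ∑ i, upperIndicator q (s i) with hA
  have hA0 : 0 ≤ A := Finset.sum_nonneg fun i _ => by unfold upperIndicator; split_ifs <;> simp
  have hsum : ∑ i, (upperIndicator q (s i) - μ.real (Set.Ici q)) = A - n * μ.real (Set.Ici q) := by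
    simp [Finset.sum_sub_distrib, hA]
  rw [hsum, ← ofReal_norm, Real.norm_eq_abs] at h
  have hF : μ (Set.Ici q) = (n : ℝ≥0∞)⁻¹ * ENNReal.ofReal (n * μ.real (Set.Ici q)) := by
    rw [ENNReal.ofReal_mul (by positivity), ofReal_measureReal, ENNReal.ofReal_natCast, ← mul_assoc,
      ENNReal.inv_mul_cancel (by exact_mod_cast hn.ne') (by simp), one_mul]
  simp only [revenue, empiricalDistribution_Ici, ← hA, ← mul_add]
  rw [hF]
  simp only [← mul_add]
  have hm : (0 : ℝ) ≤ n * μ.real (Set.Ici q) := by positivity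
  constructor
  · gcongr
    refine le_trans ?_ (add_le_add_right h _)
    rw [← ENNReal.ofReal_add hA0 (abs_nonneg _)]
    exact ENNReal.ofReal_le_ofReal (by linarith [neg_abs_le (A - n * μ.real (Set.Ici q))])
  · gcongr
    refine le_trans ?_ (add_le_add_right h _)
    rw [← ENNReal.ofReal_add hm (abs_nonneg _)]
    exact ENNReal.ofReal_le_ofReal (by linarith [le_abs_self (A - n * μ.real (Set.Ici q))])

/-- Passing to the empirical law at `q` and back at the output price costs the tail deviation twice,
each time multiplied by a price of at most `g n`; the factor `8` is `2 * 4`. -/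
lemma revenue_le_expectedRevenue_add (g : ℕ → ℕ) (t : PricingAlgorithm) (ht : IsCappedERM g t)
    (D : ValuationDistribution) (n : ℕ) (hn : 0 < n) (q : ℝ≥0) (hq : q ≤ (g n : ℝ≥0)) :
    revenue (D : Measure ℝ≥0) q ≤
      expectedRevenue t D n + ENNReal.ofReal (8 * ((g n : ℝ) / √n)) := by
  have := t.isMarkovKernel n
  have hmono : ∀ p : ℝ≥0, p ≤ (g n : ℝ≥0) → ∀ x : ℝ≥0∞, (p : ℝ≥0∞) * x ≤ (g n : ℝ≥0∞) * x := by
    intro p hp x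
    gcongr
    exact_mod_cast hp
  have key : ∀ s : Fin n → ℝ≥0, revenue (D : Measure ℝ≥0) q ≤
      (∫⁻ p, revenue (D : Measure ℝ≥0) p ∂(t.kernel n s)) +
        2 * (g n) * ((n : ℝ≥0∞)⁻¹ * tailDeviation (D : Measure ℝ≥0) s) := by
    intro s
    have h1 : ∀ᵐ p ∂(t.kernel n s), revenue (D : Measure ℝ≥0) q ≤ revenue (D : Measure ℝ≥0) p +
        2 * (g n) * ((n : ℝ≥0∞)⁻¹ * tailDeviation (D : Measure ℝ≥0) s) := by
      filter_upwards [ht n s] with p hp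
      calc revenue (D : Measure ℝ≥0) q
          ≤ _ := (revenue_le_revenue_empirical (D : Measure ℝ≥0) hn s q).1
        _ ≤ revenue (empiricalDistribution s) p + _ := add_le_add (hp.2 q hq) (hmono q hq _)
        _ ≤ (revenue (D : Measure ℝ≥0) p + _) + _ := by
          gcongr
          exact (revenue_le_revenue_empirical (D : Measure ℝ≥0) hn s p).2.trans
            (add_le_add_right (hmono p hp.1 _) _)
        _ = _ := by ring
    calc revenue (D : Measure ℝ≥0) q
        = ∫⁻ _p, revenue (D : Measure ℝ≥0) q ∂(t.kernel n s) := by simp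
      _ ≤ _ := lintegral_mono_ae h1
      _ = _ := by rw [lintegral_add_right _ measurable_const]; simp
  calc revenue (D : Measure ℝ≥0) q
      = ∫⁻ _s, revenue (D : Measure ℝ≥0) q
          ∂(Measure.pi fun _ : Fin n => (D : Measure ℝ≥0)) := by simp
    _ ≤ _ := lintegral_mono key
    _ = expectedRevenue t D n + 2 * (g n) * ((n : ℝ≥0∞)⁻¹ *
          ∫⁻ s : Fin n → ℝ≥0, tailDeviation (D : Measure ℝ≥0) s
            ∂(Measure.pi fun _ => (D : Measure ℝ≥0))) := by
      have hm := measurable_tailDeviation (D : Measure ℝ≥0) n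
      rw [lintegral_add_right _ ((hm.const_mul _).const_mul _),
        lintegral_const_mul _ (hm.const_mul _), lintegral_const_mul _ hm]
      rfl
    _ ≤ expectedRevenue t D n + 2 * (g n) * ((n : ℝ≥0∞)⁻¹ * ENNReal.ofReal (4 * √n)) := by
      gcongr
      exact lintegral_iSup_count_sub_le _ n _ hn
    _ = _ := by
      have hn' : (0 : ℝ) < n := by exact_mod_cast hn
      congr 1
      rw [← ENNReal.ofReal_natCast n, ← ENNReal.ofReal_inv_of_pos hn', ← ENNReal.ofReal_natCast (g n),
        show (2 : ℝ≥0∞) = ENNReal.ofReal 2 by simp, ← ENNReal.ofReal_mul (by norm_num),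
        ← ENNReal.ofReal_mul (by positivity), ← ENNReal.ofReal_mul (by positivity)]
      congr 1
      have hs : 0 < √(n : ℝ) := Real.sqrt_pos.2 hn'
      have hsq : √(n : ℝ) ^ 2 = n := Real.sq_sqrt hn'.le
      field_simp
      rw [hsq]
      ring

/-- Capped empirical revenue maximization learns at every rate dominating `g n / √n`. -/
theorem learnsUniversally_of_isCappedERM (R : ℕ → ℝ) (hR : ∀ n, 0 < R n) (g : ℕ → ℕ)
    (hg : Tendsto g atTop atTop) (hgR : ∀ᶠ n : ℕ in atTop, (g n : ℝ) / √(n : ℝ) ≤ R n)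
    (t : PricingAlgorithm) (ht : IsCappedERM g t) :
    LearnsUniversallyAtRate t attainedClass R := by
  rintro D ⟨hfin, p, hp⟩
  have hev : ∀ᶠ n : ℕ in atTop, revenueGap t D n ≤ 8 * R n := by
    obtain ⟨m, hm⟩ := exists_nat_ge p
    filter_upwards [hgR, hg.eventually_ge_atTop m, eventually_gt_atTop 0] with n h1 h2 h3
    have h4 := revenue_le_expectedRevenue_add g t ht D n h3 p (hm.trans (by exact_mod_cast h2))
    rw [hp] at h4
    unfold revenueGap
    have h0 : 0 ≤ (g n : ℝ) / √(n : ℝ) := by positivity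
    by_cases htop : expectedRevenue t D n = ∞
    · exfalso
      have hle : expectedRevenue t D n ≤ optRevenue D := by
        have := t.isMarkovKernel n
        calc expectedRevenue t D n ≤ ∫⁻ _s, ∫⁻ _p, optRevenue D ∂(t.kernel n _s)
              ∂(Measure.pi fun _ : Fin n => (D : Measure ℝ≥0)) :=
            lintegral_mono fun s => lintegral_mono fun p => le_iSup (revenue (D : Measure ℝ≥0)) p
          _ = optRevenue D := by simp
      exact absurd (htop ▸ hle) (not_le.2 hfin)
    · have h5 := ENNReal.toReal_mono (ENNReal.add_ne_top.2 ⟨htop, ENNReal.ofReal_ne_top⟩) h4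
      rw [ENNReal.toReal_add htop ENNReal.ofReal_ne_top, ENNReal.toReal_ofReal (by positivity)] at h5
      linarith
  obtain ⟨N, hN⟩ := eventually_atTop.1 hev
  -- The sum absorbs the finitely many sizes below `N`, where the gap is bounded only by the optimal
  -- revenue.
  set C : ℝ := 8 + ∑ n ∈ Finset.range N, (optRevenue D).toReal / R n with hC
  have hnn : ∀ n, 0 ≤ (optRevenue D).toReal / R n :=
    fun n => div_nonneg ENNReal.toReal_nonneg (hR n).le
  have h8 : 8 ≤ C := le_add_of_nonneg_right (Finset.sum_nonneg fun n _ => hnn n)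
  refine ⟨C, by linarith, 1, one_pos, fun n => ?_⟩
  rw [one_mul, Nat.floor_natCast]
  rcases lt_or_ge n N with h | h
  · have h1 : (optRevenue D).toReal / R n ≤ C :=
      (Finset.single_le_sum (f := fun n => (optRevenue D).toReal / R n) (fun n _ => hnn n)
        (Finset.mem_range.2 h)).trans (le_add_of_nonneg_left (by norm_num))
    rw [div_le_iff₀ (hR n)] at h1
    refine le_trans ?_ h1
    exact sub_le_self _ ENNReal.toReal_nonneg
  · exact (hN n h).trans (mul_le_mul_of_nonneg_right h8 (hR n).le)

/-! ### Existence of the cap and of measurable maximizers -/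

/-- A slowly growing cap below `R n * √n`. -/
lemma exists_cap (R : ℕ → ℝ) (hR : ∀ n, 0 < R n)
    (h : Tendsto (fun n : ℕ => R n * √(n : ℝ)) atTop atTop) :
    ∃ g : ℕ → ℕ, Monotone g ∧ Tendsto g atTop atTop ∧
      ∀ᶠ n : ℕ in atTop, (g n : ℝ) / √(n : ℝ) ≤ R n := by
  have hnn : ∀ n : ℕ, 0 ≤ R n * √(n : ℝ) := fun n => mul_nonneg (hR n).le (Real.sqrt_nonneg _)
  have hbdd : ∀ n : ℕ, BddBelow (Set.range fun m : ℕ => R (n + m) * √((n + m : ℕ) : ℝ)) :=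
    fun n => ⟨0, by rintro _ ⟨m, rfl⟩; exact hnn _⟩
  -- The infimum over the tail of the sequence is monotone, stays below the current term, and still
  -- diverges.
  refine ⟨fun n => ⌊⨅ m : ℕ, R (n + m) * √((n + m : ℕ) : ℝ)⌋₊, ?_, ?_, ?_⟩
  · intro a b hab
    refine Nat.floor_mono (le_ciInf fun m => ?_)
    refine (ciInf_le (hbdd a) (b - a + m)).trans (le_of_eq ?_)
    rw [show a + (b - a + m) = b + m by omega]
  · refine tendsto_atTop.2 fun K => ?_
    obtain ⟨N, hN⟩ := eventually_atTop.1 (h.eventually_ge_atTop (K : ℝ))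
    filter_upwards [eventually_ge_atTop N] with n hn
    refine Nat.le_floor (le_ciInf fun m => hN _ (by omega))
  · filter_upwards [eventually_gt_atTop 0] with n hn
    have hs : 0 < √(n : ℝ) := Real.sqrt_pos.2 (by exact_mod_cast hn)
    rw [div_le_iff₀ hs]
    refine (Nat.floor_le (le_ciInf fun m => hnn _)).trans ?_
    simpa using ciInf_le (hbdd n) 0

/-- The candidate prices of a capped empirical revenue maximization: the sample points truncated at
the cap `c`, and the price `0`. -/
noncomputable def candidatePrice {n : ℕ} (c : ℝ≥0) (k : ℕ) (s : Fin n → ℝ≥0) : ℝ≥0 :=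
  if h : k < n then min (s ⟨k, h⟩) c else 0

lemma measurable_candidatePrice {n : ℕ} (c : ℝ≥0) (k : ℕ) :
    Measurable (candidatePrice c k : (Fin n → ℝ≥0) → ℝ≥0) := by
  unfold candidatePrice
  split_ifs with h
  · exact (measurable_pi_apply _).min measurable_const
  · exact measurable_const

lemma measurable_empirical_revenue {n : ℕ} (f : (Fin n → ℝ≥0) → ℝ≥0) (hf : Measurable f) :
    Measurable fun s => revenue (empiricalDistribution s) (f s) := by
  simp only [revenue, empiricalDistribution_Ici]
  refine hf.coe_nnreal_ennreal.mul (Measurable.const_mul (Measurable.ennreal_ofReal ?_) _)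
  refine Finset.measurable_sum _ fun i _ => ?_
  exact Measurable.ite (measurableSet_le hf (measurable_pi_apply i)) measurable_const
    measurable_const

/-- Raising `q` to the least sample point above it, or to the cap if that comes first, loses no
buyer. If no sample point reaches `q`, the revenue is `0` and any candidate will do. -/
lemma exists_candidatePrice_ge {n : ℕ} (c : ℝ≥0) (s : Fin n → ℝ≥0) (q : ℝ≥0) (hq : q ≤ c) :
    ∃ k ≤ n, revenue (empiricalDistribution s) q ≤
      revenue (empiricalDistribution s) (candidatePrice c k s) := by
  simp only [revenue, empiricalDistribution_Ici]
  rcases (Finset.univ.filter fun i => q ≤ s i).eq_empty_or_nonempty with he | hne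
  · refine ⟨n, le_rfl, ?_⟩
    have h0 : ∑ i, upperIndicator q (s i) = 0 := Finset.sum_eq_zero fun i _ => by
      have := Finset.filter_eq_empty_iff.1 he (Finset.mem_univ i)
      simp [upperIndicator, this]
    simp [h0]
  · obtain ⟨i, hi, hmin⟩ := Finset.exists_min_image _ s hne
    rw [Finset.mem_filter] at hi
    refine ⟨i, i.2.le, ?_⟩
    have hc : candidatePrice c i s = min (s i) c := by simp [candidatePrice]
    rw [hc]
    gcongr with j _
    · exact le_min hi.2 hq
    · unfold upperIndicator
      by_cases hj : q ≤ s j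
      · have : min (s i) c ≤ s j :=
          (min_le_left _ _).trans (hmin j (Finset.mem_filter.2 ⟨Finset.mem_univ j, hj⟩))
        simp [hj, this]
      · simp only [hj, if_false]
        split_ifs <;> simp

lemma candidatePrice_le {n : ℕ} (c : ℝ≥0) (k : ℕ) (s : Fin n → ℝ≥0) : candidatePrice c k s ≤ c := by
  unfold candidatePrice
  split_ifs with h
  · exact min_le_right _ _
  · exact zero_le

/-- Measurable capped empirical revenue maximizers exist. -/
theorem exists_isCappedERM (g : ℕ → ℕ) : ∃ t : PricingAlgorithm, IsCappedERM g t := by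
  classical
  have hex : ∀ n : ℕ, ∃ f : (Fin n → ℝ≥0) → ℝ≥0, Measurable f ∧ ∀ s, f s ≤ g n ∧
      ∀ q : ℝ≥0, q ≤ (g n : ℝ≥0) →
        revenue (empiricalDistribution s) q ≤ revenue (empiricalDistribution s) (f s) := by
    intro n
    have hex' : ∀ s : Fin n → ℝ≥0, ∃ k, ∀ j ≤ n,
        revenue (empiricalDistribution s) (candidatePrice (g n) j s) ≤
          revenue (empiricalDistribution s) (candidatePrice (g n) k s) := by
      intro s
      obtain ⟨k, -, hk⟩ := Finset.exists_max_image (Finset.range (n + 1))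
        (fun k => revenue (empiricalDistribution s) (candidatePrice (g n) k s)) (by simp)
      exact ⟨k, fun j hj => hk j (Finset.mem_range.2 (by omega))⟩
    -- Taking the first maximizing index makes the selection measurable.
    refine ⟨fun s => candidatePrice (g n) (Nat.find (hex' s)) s,
      Measurable.find (fun k => measurable_candidatePrice _ k) (fun k => ?_) hex', fun s =>
      ⟨candidatePrice_le _ _ _, fun q hq => ?_⟩⟩
    · simp only [Set.ofPred_forall]
      refine MeasurableSet.iInter fun j => MeasurableSet.iInter fun _ => ?_
      exact measurableSet_le (measurable_empirical_revenue _ (measurable_candidatePrice _ j))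
        (measurable_empirical_revenue _ (measurable_candidatePrice _ k))
    · obtain ⟨k, hk, hle⟩ := exists_candidatePrice_ge (g n : ℝ≥0) s q hq
      exact hle.trans (Nat.find_spec (hex' s) k hk)
  choose f hf hfs using hex
  refine ⟨⟨fun n => Kernel.deterministic (f n) (hf n), fun n => inferInstance⟩, fun n s => ?_⟩
  have hset : MeasurableSet {p : ℝ≥0 | p = f n s} := measurableSet_singleton _
  have : ∀ᵐ p ∂(Kernel.deterministic (f n) (hf n) s), p = f n s := by
    rw [Kernel.deterministic_apply, ae_dirac_iff hset]
  filter_upwards [this] with p hp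
  rw [hp]
  exact hfs n s

/-! ### Indistinguishability of nearby product laws -/

section LikelihoodRatio

variable {X : Type*} [MeasurableSpace X] (μ : Measure X) [IsProbabilityMeasure μ] (n : ℕ)
  (h : X → ℝ)

lemma pi_withDensity_ofReal (hi : Integrable h μ) (h0 : ∀ x, 0 ≤ h x)
    [SigmaFinite (μ.withDensity fun x => ENNReal.ofReal (h x))] :
    Measure.pi (fun _ : Fin n => μ.withDensity fun x => ENNReal.ofReal (h x)) =
      (Measure.pi fun _ : Fin n => μ).withDensity fun s => ENNReal.ofReal (∏ i, h (s i)) := by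
  refine Measure.pi_eq fun S hS => ?_
  rw [withDensity_apply _ (MeasurableSet.univ_pi hS), Measure.restrict_pi_pi,
    ← ofReal_integral_eq_lintegral_ofReal (Integrable.fintype_prod fun i => hi.restrict)
      (Eventually.of_forall fun s => Finset.prod_nonneg fun i _ => h0 _),
    integral_fintype_prod_eq_prod,
    ENNReal.ofReal_prod_of_nonneg fun i _ => integral_nonneg fun x => h0 x]
  refine Finset.prod_congr rfl fun i _ => ?_
  rw [withDensity_apply _ (hS i),
    ofReal_integral_eq_lintegral_ofReal hi.restrict (Eventually.of_forall fun x => h0 x)]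

variable {h}

/-- The chi-square divergence tensorizes: the likelihood ratio has mean `1` and second moment `(∫ h
^ 2) ^ n ≤ (1 + ε ^ 2) ^ n ≤ exp (1 / 32)`. -/
lemma integral_prod_sub_one_sq_le (hm : Measurable h) {ε : ℝ} (hε : ∀ x, |h x - 1| ≤ ε)
    (h1 : ∫ x, h x ∂μ = 1) (hn : n * ε ^ 2 ≤ 1 / 32) :
    Integrable (fun s : Fin n → X => (∏ i, h (s i) - 1) ^ 2) (Measure.pi fun _ => μ) ∧
    ∫ s : Fin n → X, (∏ i, h (s i) - 1) ^ 2 ∂(Measure.pi fun _ => μ) ≤ 1 / 16 := by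
  have hi : Integrable h μ := by
    refine Integrable.of_bound hm.aestronglyMeasurable (1 + ε) (Eventually.of_forall fun x => ?_)
    rw [Real.norm_eq_abs]
    have := abs_add_le (h x - 1) 1
    rw [sub_add_cancel, abs_one] at this
    linarith [hε x]
  have hi2 : Integrable (fun x => (h x - 1) ^ 2) μ := by
    refine Integrable.of_bound ((hm.sub_const 1).pow_const 2).aestronglyMeasurable (ε ^ 2)
      (Eventually.of_forall fun x => ?_)
    rw [Real.norm_eq_abs, abs_pow]
    exact pow_le_pow_left₀ (abs_nonneg _) (hε x) 2
  have hsq : (fun x => h x ^ 2) = fun x => (h x - 1) ^ 2 + (2 * h x - 1) := by ext x; ring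
  have hi3 : Integrable (fun x => 2 * h x - 1) μ := (hi.const_mul 2).sub (integrable_const _)
  have hi4 : Integrable (fun x => h x ^ 2) μ := by rw [hsq]; exact hi2.add hi3
  have hle : ∫ x, h x ^ 2 ∂μ ≤ 1 + ε ^ 2 := by
    rw [hsq, integral_add hi2 hi3, integral_sub (hi.const_mul 2) (integrable_const _),
      integral_const_mul, h1]
    have : ∫ x, (h x - 1) ^ 2 ∂μ ≤ ∫ _x, ε ^ 2 ∂μ := by
      refine integral_mono hi2 (integrable_const _) fun x => ?_
      have := pow_le_pow_left₀ (abs_nonneg _) (hε x) 2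
      rwa [sq_abs] at this
    simp at this ⊢
    linarith
  have hI1 : Integrable (fun s : Fin n → X => ∏ i, h (s i)) (Measure.pi fun _ => μ) :=
    Integrable.fintype_prod fun _ => hi
  have hI2 : Integrable (fun s : Fin n → X => ∏ i, h (s i) ^ 2) (Measure.pi fun _ => μ) :=
    Integrable.fintype_prod (f := fun (_ : Fin n) x => h x ^ 2) fun _ => hi4
  have hexp : (fun s : Fin n → X => (∏ i, h (s i) - 1) ^ 2) =
      fun s => ∏ i, h (s i) ^ 2 - (2 * ∏ i, h (s i) - 1) := by
    ext s
    rw [Finset.prod_pow]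
    ring
  have hI3 : Integrable (fun s : Fin n → X => 2 * ∏ i, h (s i) - 1) (Measure.pi fun _ => μ) :=
    (hI1.const_mul 2).sub (integrable_const _)
  rw [hexp]
  refine ⟨hI2.sub hI3, ?_⟩
  rw [integral_sub hI2 hI3, integral_sub (hI1.const_mul 2) (integrable_const _),
    integral_const_mul, integral_fintype_prod_eq_pow (fun x => h x ^ 2),
    integral_fintype_prod_eq_pow h, h1]
  simp only [Fintype.card_fin, one_pow, integral_const, probReal_univ, smul_eq_mul]
  have hpow : (∫ x, h x ^ 2 ∂μ) ^ n ≤ 1 + 1 / 16 := by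
    calc (∫ x, h x ^ 2 ∂μ) ^ n ≤ (Real.exp (ε ^ 2)) ^ n := by
          refine pow_le_pow_left₀ (integral_nonneg fun x => sq_nonneg _) ?_ n
          linarith [Real.add_one_le_exp (ε ^ 2)]
      _ = Real.exp (n * ε ^ 2) := by rw [← Real.exp_nat_mul]
      _ ≤ Real.exp (1 / 32) := Real.exp_le_exp.2 hn
      _ ≤ 1 + 1 / 16 := by
        have h2 := Real.one_sub_le_exp_neg (1 / 32)
        rw [Real.exp_neg] at h2
        have h3 := Real.exp_pos (1 / 32)
        rw [le_inv_comm₀ (by norm_num) h3] at h2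
        exact h2.trans (by norm_num)
  linarith

/-- A small perturbation of a law changes the expectation of a test on `n` samples by at most
`1/4`. -/
lemma integral_pi_sub_le_integral_pi_withDensity (hm : Measurable h) (h0 : ∀ x, 0 ≤ h x) {ε : ℝ}
    (hε : ∀ x, |h x - 1| ≤ ε) (h1 : ∫ x, h x ∂μ = 1) (hn : n * ε ^ 2 ≤ 1 / 32)
    [SigmaFinite (μ.withDensity fun x => ENNReal.ofReal (h x))]
    (φ : (Fin n → X) → ℝ) (hφ : Measurable φ) (hφ0 : ∀ s, 0 ≤ φ s) (hφ1 : ∀ s, φ s ≤ 1) :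
    ∫ s, φ s ∂(Measure.pi fun _ => μ) - 1 / 4 ≤
      ∫ s, φ s ∂(Measure.pi fun _ => μ.withDensity fun x => ENNReal.ofReal (h x)) := by
  have hi : Integrable h μ := by
    by_contra hcon
    rw [integral_undef hcon] at h1
    exact zero_ne_one h1
  obtain ⟨hI, hle⟩ := integral_prod_sub_one_sq_le μ n hm hε h1 hn
  have hL0 : ∀ s : Fin n → X, 0 ≤ ∏ i, h (s i) := fun s => Finset.prod_nonneg fun i _ => h0 _
  have hLm : Measurable fun s : Fin n → X => ∏ i, h (s i) :=
    Finset.measurable_prod _ fun i _ => hm.comp (measurable_pi_apply i)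
  have hLi : Integrable (fun s : Fin n → X => ∏ i, h (s i)) (Measure.pi fun _ => μ) :=
    Integrable.fintype_prod fun _ => hi
  rw [pi_withDensity_ofReal μ n h hi h0,
    integral_withDensity_eq_integral_toReal_smul hLm.ennreal_ofReal
      (Eventually.of_forall fun s => ENNReal.ofReal_lt_top)]
  have hφi : Integrable φ (Measure.pi fun _ => μ) :=
    Integrable.of_bound hφ.aestronglyMeasurable 1 (Eventually.of_forall fun s => by
      rw [Real.norm_eq_abs, abs_of_nonneg (hφ0 s)]; exact hφ1 s)
  have hq : Integrable (fun s : Fin n → X => 2 * (∏ i, h (s i) - 1) ^ 2 + 1 / 8)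
      (Measure.pi fun _ => μ) := (hI.const_mul 2).add (integrable_const _)
  have hr : Integrable (fun s => φ s - (2 * (∏ i, h (s i) - 1) ^ 2 + 1 / 8))
      (Measure.pi fun _ => μ) :=
    hφi.sub hq
  have hLφ : Integrable (fun s => (ENNReal.ofReal (∏ i, h (s i))).toReal • φ s)
      (Measure.pi fun _ => μ) := by
    refine hLi.mono (hLm.ennreal_ofReal.ennreal_toReal.smul hφ).aestronglyMeasurable
      (Eventually.of_forall fun s => ?_)
    rw [ENNReal.toReal_ofReal (hL0 s), norm_smul, Real.norm_eq_abs (φ s), abs_of_nonneg (hφ0 s)]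
    exact mul_le_of_le_one_right (norm_nonneg _) (hφ1 s)
  -- With `u` the likelihood ratio minus `1`, `u ≥ -(2 * u ^ 2 + 1 / 8)` by AM-GM, and `φ` lies in
  -- `[0, 1]`. The loss integrates to at most `2 / 16 + 1 / 8 = 1 / 4`.
  have hmono := integral_mono hr hLφ fun s => by
    rw [ENNReal.toReal_ofReal (hL0 s), smul_eq_mul]
    have := hφ0 s
    have := hφ1 s
    nlinarith [sq_nonneg (4 * (∏ i, h (s i) - 1) + 1), sq_nonneg (∏ i, h (s i) - 1)]
  refine le_trans ?_ hmono
  rw [integral_sub hφi hq,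
    integral_add (hI.const_mul 2) (integrable_const _), integral_const_mul]
  simp only [integral_const, probReal_univ, smul_eq_mul]
  linarith

end LikelihoodRatio

/-! ### Flat revenue curves and their local perturbations -/

/-- `μ` is a probability measure on `[0, 1]` whose revenue is at most `M` everywhere and equal to
`M` on `[a, b]`. -/
structure IsFlat (μ : Measure ℝ≥0) (a b : ℝ≥0) (M : ℝ) : Prop where
  prob : IsProbabilityMeasure μ
  supp : μ (Set.Icc 0 1)ᶜ = 0
  pos : 0 < a
  lt : a < b
  revenue_pos : 0 < M
  revenue_le : ∀ v : ℝ≥0, v * μ.real (Set.Ici v) ≤ M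
  revenue_eq : ∀ v ∈ Set.Icc a b, v * μ.real (Set.Ici v) = M

/-- The density of the perturbation that raises the revenue on `[x, y]`. -/
noncomputable def bumpDensity (x x' y' y : ℝ≥0) (κ : ℝ) (v : ℝ≥0) : ℝ :=
  if v < x then 1 else if v < x' then 1 - κ * (x / (x' - x)) else
  if v < y' then 1 + κ else if v < y then 1 + κ * (y / (y - y')) else 1

/-- The perturbation of `μ` with density `bumpDensity`. -/
noncomputable def bump (μ : Measure ℝ≥0) (x x' y' y : ℝ≥0) (κ : ℝ) : Measure ℝ≥0 :=
  μ.withDensity fun v => ENNReal.ofReal (bumpDensity x x' y' y κ v)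

lemma measurable_bumpDensity (x x' y' y : ℝ≥0) (κ : ℝ) : Measurable (bumpDensity x x' y' y κ) := by
  unfold bumpDensity
  exact Measurable.ite measurableSet_Iio measurable_const
    (Measurable.ite measurableSet_Iio measurable_const
      (Measurable.ite measurableSet_Iio measurable_const
        (Measurable.ite measurableSet_Iio measurable_const measurable_const)))

lemma abs_bumpDensity_sub_one_le {x x' y' y : ℝ≥0} (hxx' : x < x') (hyy' : y' < y)
    {κ : ℝ} (hκ : 0 ≤ κ) {K : ℝ} (hK : 1 ≤ K) (h1 : (x : ℝ) / (x' - x) ≤ K)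
    (h2 : (y : ℝ) / (y - y') ≤ K) (v : ℝ≥0) : |bumpDensity x x' y' y κ v - 1| ≤ κ * K := by
  have hx : (0 : ℝ) < x' - x := sub_pos.2 (by exact_mod_cast hxx')
  have hy : (0 : ℝ) < y - y' := sub_pos.2 (by exact_mod_cast hyy')
  have h3 : 0 ≤ κ * K := mul_nonneg hκ (by linarith)
  have h4 : 0 ≤ κ * (x / (x' - x)) := by positivity
  have h5 : 0 ≤ κ * (y / (y - y')) := by positivity
  unfold bumpDensity
  split_ifs
  · simpa using h3
  · rw [sub_sub_cancel_left, abs_neg, abs_of_nonneg h4]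
    gcongr
  · rw [add_sub_cancel_left, abs_of_nonneg hκ]
    exact le_mul_of_one_le_right hκ hK
  · rw [add_sub_cancel_left, abs_of_nonneg h5]
    gcongr
  · simpa using h3

lemma withDensity_real_of_eq_const (μ : Measure ℝ≥0) (h : ℝ≥0 → ℝ) (c : ℝ) (hc : 0 ≤ c)
    (E : Set ℝ≥0) (hE : MeasurableSet E) (hh : ∀ v ∈ E, h v = c) :
    (μ.withDensity fun v => ENNReal.ofReal (h v)).real E = c * μ.real E := by
  have : (μ.withDensity fun v => ENNReal.ofReal (h v)) E = ENNReal.ofReal c * μ E := by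
    rw [withDensity_apply _ hE, setLIntegral_congr_fun hE (g := fun _ => ENNReal.ofReal c)
      fun v hv => by simp only [hh v hv]]
    simp
  rw [measureReal_def, this, ENNReal.toReal_mul, ENNReal.toReal_ofReal hc, measureReal_def]

lemma measureReal_Ici_eq_add (μ : Measure ℝ≥0) [IsFiniteMeasure μ] {u v : ℝ≥0} (huv : u ≤ v) :
    μ.real (Set.Ici u) = μ.real (Set.Ico u v) + μ.real (Set.Ici v) := by
  rw [← Set.Ico_union_Ici_eq_Ici huv, measureReal_union _ measurableSet_Ici]
  exact (Set.Iio_disjoint_Ici le_rfl).mono_left fun z hz => hz.2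

section Bump

variable {μ : Measure ℝ≥0} {a b : ℝ≥0} {M : ℝ} {x x' y' y : ℝ≥0} {η : ℝ}

lemma bump_restrict_compl (hxx' : x < x') (hx'y' : x' < y') (hy'y : y' < y) (κ : ℝ) :
    (bump μ x x' y' y κ).restrict (Set.Ico x y)ᶜ = μ.restrict (Set.Ico x y)ᶜ := by
  rw [bump, restrict_withDensity measurableSet_Ico.compl]
  refine (withDensity_congr_ae ?_).trans withDensity_one
  filter_upwards [ae_restrict_mem measurableSet_Ico.compl] with v hv
  have hv' : v < x ∨ y ≤ v := by
    by_contra! hcon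
    exact hv hcon
  rcases hv' with h | h
  · simp [bumpDensity, h]
  · simp [bumpDensity, not_lt.2 h, not_lt.2 (hy'y.le.trans h),
      not_lt.2 ((hx'y'.trans hy'y).le.trans h),
      not_lt.2 ((hxx'.trans (hx'y'.trans hy'y)).le.trans h)]

/-- Raising a flat piece of the revenue curve: the revenue grows linearly from `M` to `M + η` on
`[x, x']`, equals `M + η` on `[x', y']`, and decreases to `M` on `[y', y]`. -/
lemma isFlat_bump (hμ : IsFlat μ a b M) (hax : a ≤ x) (hxx' : x < x') (hx'y' : x' < y')
    (hy'y : y' < y) (hyb : y ≤ b) (hη : 0 ≤ η) (hβ : η / M * (x / (x' - x)) ≤ 1) :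
    IsFlat (bump μ x x' y' y (η / M)) x' y' (M + η) ∧
    (∀ v, v ∉ Set.Ico x y →
      (bump μ x x' y' y (η / M)).real (Set.Ici v) = μ.real (Set.Ici v)) := by
  have hprob := hμ.prob
  have hM := hμ.revenue_pos
  have hκ : 0 ≤ η / M := by positivity
  have hx0 : (0 : ℝ) < x := by exact_mod_cast hμ.pos.trans_le hax
  have hxx : (x : ℝ) < x' := by exact_mod_cast hxx'
  have hxy : (x' : ℝ) < y' := by exact_mod_cast hx'y'
  have hyy : (y' : ℝ) < y := by exact_mod_cast hy'y
  have hγ : 0 ≤ η / M * ((y : ℝ) / (y - y')) := by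
    have : (0 : ℝ) < y - y' := sub_pos.2 hyy
    positivity
  set ν := bump μ x x' y' y (η / M) with hν
  have hfin : IsFiniteMeasure ν := by
    refine isFiniteMeasure_withDensity_ofReal (Integrable.hasFiniteIntegral ?_)
    refine Integrable.of_bound (measurable_bumpDensity _ _ _ _ _).aestronglyMeasurable
      (1 + η / M * (max 1 (max ((x : ℝ) / (x' - x)) (y / (y - y'))))) (Eventually.of_forall fun v => ?_)
    have h1 := abs_bumpDensity_sub_one_le hxx' hy'y hκ
      (le_max_left 1 (max ((x : ℝ) / (x' - x)) (y / (y - y'))))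
      ((le_max_left _ _).trans (le_max_right _ _)) ((le_max_right _ _).trans (le_max_right _ _)) v
    have h2 := abs_add_le (bumpDensity x x' y' y (η / M) v - 1) 1
    rw [sub_add_cancel, abs_one] at h2
    rw [Real.norm_eq_abs]
    linarith
  have hflat : ∀ v : ℝ≥0, x ≤ v → v ≤ y → μ.real (Set.Ici v) = M / v := fun v h1 h2 => by
    have hv : (0 : ℝ) < v := hx0.trans_le (by exact_mod_cast h1)
    rw [eq_div_iff hv.ne', mul_comm]
    exact hμ.revenue_eq v ⟨hax.trans h1, h2.trans hyb⟩
  -- Tails are computed from right to left, one piece of constant density at a time, starting beyond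
  -- `y` where nothing changes.
  have hpiece : ∀ (c : ℝ) (u v : ℝ≥0), 0 ≤ c → u ≤ v →
      (∀ z ∈ Set.Ico u v, bumpDensity x x' y' y (η / M) z = c) →
      ν.real (Set.Ici u) = c * (μ.real (Set.Ici u) - μ.real (Set.Ici v)) + ν.real (Set.Ici v) := by
    intro c u v hc huv hz
    rw [measureReal_Ici_eq_add ν huv, measureReal_Ici_eq_add μ huv, add_sub_cancel_right,
      hν, bump, withDensity_real_of_eq_const μ _ c hc _ measurableSet_Ico hz]
  have htop : ∀ v, y ≤ v → ν.real (Set.Ici v) = μ.real (Set.Ici v) := by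
    intro v hv
    rw [hν, bump, withDensity_real_of_eq_const μ _ 1 zero_le_one _ measurableSet_Ici,
      one_mul]
    intro z hz
    have hyz : y ≤ z := hv.trans hz
    simp [bumpDensity, not_lt.2 hyz, not_lt.2 (hy'y.le.trans hyz),
      not_lt.2 ((hx'y'.trans hy'y).le.trans hyz),
      not_lt.2 ((hxx'.trans (hx'y'.trans hy'y)).le.trans hyz)]
  have hdown : ∀ v, y' ≤ v → v ≤ y →
      v * ν.real (Set.Ici v) = M + η * ((y - v) / (y - y')) := by
    intro v h1 h2
    have h1' : x ≤ v := (hxx'.trans hx'y').le.trans h1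
    have hv : (0 : ℝ) < v := hx0.trans_le (by exact_mod_cast h1')
    have hd : (y : ℝ) - y' ≠ 0 := (sub_pos.2 hyy).ne'
    have hy0 : (y : ℝ) ≠ 0 := by
      have : (v : ℝ) ≤ y := by exact_mod_cast h2
      linarith
    rw [hpiece (1 + η / M * (y / (y - y'))) v y (by linarith) h2, htop y le_rfl,
      hflat v h1' h2, hflat y (h1'.trans h2) le_rfl]
    · field_simp
      ring
    · intro z hz
      simp [bumpDensity, hz.2, not_lt.2 (h1.trans hz.1), not_lt.2 (h1'.trans hz.1),
        not_lt.2 (hx'y'.le.trans (h1.trans hz.1))]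
  have hmid : ∀ v, x' ≤ v → v ≤ y' → v * ν.real (Set.Ici v) = M + η := by
    intro v h1 h2
    have hxv : x ≤ v := hxx'.le.trans h1
    have hv : (0 : ℝ) < v := hx0.trans_le (by exact_mod_cast hxv)
    have hy'0 : (0 : ℝ) < y' := hv.trans_le (by exact_mod_cast h2)
    have hd := hdown y' le_rfl hy'y.le
    rw [div_self (sub_pos.2 hyy).ne', mul_one] at hd
    have hd' : ν.real (Set.Ici y') = (M + η) / y' := by
      rw [eq_div_iff hy'0.ne', mul_comm]; exact hd
    rw [hpiece (1 + η / M) v y' (by linarith) h2, hd', hflat v hxv (h2.trans hy'y.le),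
      hflat y' (hxv.trans h2) hy'y.le]
    · field_simp
      ring
    · intro z hz
      simp [bumpDensity, hz.2, not_lt.2 (h1.trans hz.1), not_lt.2 (hxv.trans hz.1)]
  have hup : ∀ v, x ≤ v → v ≤ x' →
      v * ν.real (Set.Ici v) = M + η * ((v - x) / (x' - x)) := by
    intro v hxv h2
    have hv : (0 : ℝ) < v := hx0.trans_le (by exact_mod_cast hxv)
    have hx'0 : (0 : ℝ) < x' := hv.trans_le (by exact_mod_cast h2)
    have hd : (x' : ℝ) - x ≠ 0 := (sub_pos.2 hxx).ne'
    have hd' : ν.real (Set.Ici x') = (M + η) / x' := by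
      rw [eq_div_iff hx'0.ne', mul_comm]; exact hmid x' le_rfl hx'y'.le
    have hx'y : x' ≤ y := (hx'y'.trans hy'y).le
    rw [hpiece (1 - η / M * (x / (x' - x))) v x' (by linarith) h2, hd', hflat v hxv (h2.trans hx'y),
      hflat x' hxx'.le hx'y]
    · field_simp
      ring
    · intro z hz
      simp [bumpDensity, hz.2, not_lt.2 (hxv.trans hz.1)]
  -- The density on `[x, x')` is lowered by exactly the mass added on `[x', y)`, so the tail at `x`
  -- is restored; at `v = 0` this says that the total mass is still `1`.
  have hbot : ∀ v, v ≤ x → ν.real (Set.Ici v) = μ.real (Set.Ici v) := by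
    intro v hv
    have hx1 := hup x le_rfl hxx'.le
    rw [sub_self, zero_div, mul_zero, add_zero] at hx1
    have hx2 : ν.real (Set.Ici x) = μ.real (Set.Ici x) := by
      rw [hflat x le_rfl (hxx'.trans (hx'y'.trans hy'y)).le, eq_div_iff hx0.ne', mul_comm]
      exact hx1
    rw [hpiece 1 v x zero_le_one hv fun z hz => by simp [bumpDensity, hz.2], hx2]
    ring
  have hout : ∀ v, v ∉ Set.Ico x y → ν.real (Set.Ici v) = μ.real (Set.Ici v) := by
    intro v hv
    rcases lt_or_ge v x with h | h
    · exact hbot v h.le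
    · exact htop v (not_lt.1 fun h' => hv ⟨h, h'⟩)
  refine ⟨⟨?_, ?_, hμ.pos.trans_le (hax.trans hxx'.le), hx'y', by linarith, fun v => ?_,
    fun v hv => hmid v hv.1 hv.2⟩, hout⟩
  · have h1 := hbot 0 zero_le
    have h2 : Set.Ici (0 : ℝ≥0) = Set.univ := by ext; simp
    rw [h2, probReal_univ (μ := μ)] at h1
    refine ⟨?_⟩
    rw [measureReal_def] at h1
    exact (ENNReal.toReal_eq_one_iff _).1 h1
  · exact withDensity_absolutelyContinuous _ _ hμ.supp
  · by_cases hv : v ∈ Set.Ico x y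
    · have hle : ∀ r : ℝ, r ≤ 1 → M + η * r ≤ M + η := fun r hr => by nlinarith
      rcases le_total v x' with h1 | h1
      · rw [hup v hv.1 h1]
        refine hle _ ((div_le_one (sub_pos.2 hxx)).2 ?_)
        have : (v : ℝ) ≤ x' := by exact_mod_cast h1
        linarith
      · rcases le_total v y' with h2 | h2
        · exact (hmid v h1 h2).le
        · rw [hdown v h2 hv.2.le]
          refine hle _ ((div_le_one (sub_pos.2 hyy)).2 ?_)
          have : (y' : ℝ) ≤ v := by exact_mod_cast h2
          linarith
    · rw [hout v hv]
      linarith [hμ.revenue_le v]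

end Bump

/-! ### One stage of the adversarial construction -/

/-- A local perturbation of a flat law that is hard to detect from `n` samples. -/
lemma IsFlat.exists_perturbation {μ : Measure ℝ≥0} {a b : ℝ≥0} {M : ℝ} (hμ : IsFlat μ a b M)
    {x l w : ℝ≥0} {η K : ℝ} {n : ℕ} (hax : a ≤ x) (hl : 0 < l) (hxb : x + l ≤ b) (hw : 0 < w)
    (hwl : w < l / 3) (hη : 0 ≤ η) (hK1 : 1 ≤ K) (hK : (b : ℝ) / (l / 3 - w) ≤ K)
    (hε : η / M * K ≤ 1) (hn : n * (η / M * K) ^ 2 ≤ 1 / 32)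
    (hwn : n * ((M + η) * w) ≤ (a : ℝ) ^ 2 / 8) :
    ∃ ν : Measure ℝ≥0, IsFlat ν (x + l / 3) (x + l / 3 + w) (M + η) ∧
      ν.restrict (Set.Ico x (x + l))ᶜ = μ.restrict (Set.Ico x (x + l))ᶜ ∧
      (∀ v, v ∉ Set.Ico x (x + l) → v * ν.real (Set.Ici v) ≤ M) ∧
      n * ν.real (Set.Ico (x + l / 3) (x + l / 3 + w)) ≤ 1 / 8 ∧
      ∀ φ : (Fin n → ℝ≥0) → ℝ, Measurable φ → (∀ s, 0 ≤ φ s) → (∀ s, φ s ≤ 1) →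
        ∫ s, φ s ∂(Measure.pi fun _ => μ) - 1 / 4 ≤ ∫ s, φ s ∂(Measure.pi fun _ => ν) := by
  have hprob := hμ.prob
  have hM := hμ.revenue_pos
  have ha := hμ.pos
  have hκ : 0 ≤ η / M := by positivity
  have hl3 : 0 < l / 3 := by positivity
  have hxx' : x < x + l / 3 := lt_add_of_pos_right _ hl3
  have hx'y' : x + l / 3 < x + l / 3 + w := lt_add_of_pos_right _ hw
  have hwlR : (w : ℝ) < l / 3 := by exact_mod_cast hwl
  have hlR : (0 : ℝ) < l := by exact_mod_cast hl
  have hwR : (0 : ℝ) < w := by exact_mod_cast hw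
  have hxbR : (x : ℝ) + l ≤ b := by exact_mod_cast hxb
  have haxR : (a : ℝ) ≤ x := by exact_mod_cast hax
  have haR : (0 : ℝ) < a := by exact_mod_cast ha
  have hy'y : x + l / 3 + w < x + l := by
    rw [← NNReal.coe_lt_coe]
    push_cast
    linarith
  have hb0 : (0 : ℝ) ≤ b := b.2
  have hd : (0 : ℝ) < l / 3 - w := by linarith
  have hk1 : (x : ℝ) / (((x + l / 3 : ℝ≥0) : ℝ) - x) ≤ K := by
    refine le_trans ?_ hK
    push_cast
    rw [add_sub_cancel_left]
    exact div_le_div₀ hb0 (by linarith) hd (by linarith)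
  have hk2 : ((x + l : ℝ≥0) : ℝ) / (((x + l : ℝ≥0) : ℝ) - (x + l / 3 + w : ℝ≥0)) ≤ K := by
    refine le_trans ?_ hK
    push_cast
    exact div_le_div₀ hb0 hxbR hd (by linarith)
  obtain ⟨hflat, hout⟩ := isFlat_bump hμ hax hxx' hx'y' hy'y hxb hη
    ((mul_le_mul_of_nonneg_left hk1 hκ).trans hε)
  have hνprob := hflat.prob
  have hbd := abs_bumpDensity_sub_one_le hxx' hy'y hκ hK1 hk1 hk2
  have h0 : ∀ v, 0 ≤ bumpDensity x (x + l / 3) (x + l / 3 + w) (x + l) (η / M) v := fun v => by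
    have := neg_abs_le (bumpDensity x (x + l / 3) (x + l / 3 + w) (x + l) (η / M) v - 1)
    linarith [hbd v]
  have hi : Integrable (bumpDensity x (x + l / 3) (x + l / 3 + w) (x + l) (η / M)) μ := by
    refine Integrable.of_bound (measurable_bumpDensity _ _ _ _ _).aestronglyMeasurable 2
      (Eventually.of_forall fun v => ?_)
    rw [Real.norm_eq_abs, abs_of_nonneg (h0 v)]
    linarith [le_abs_self (bumpDensity x (x + l / 3) (x + l / 3 + w) (x + l) (η / M) v - 1), hbd v]
  have hint : ∫ v, bumpDensity x (x + l / 3) (x + l / 3 + w) (x + l) (η / M) v ∂μ = 1 := by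
    have h1 := hνprob.measure_univ
    rw [bump, withDensity_apply _ MeasurableSet.univ, Measure.restrict_univ,
      ← ofReal_integral_eq_lintegral_ofReal hi (Eventually.of_forall h0)] at h1
    exact ENNReal.ofReal_eq_one.1 h1
  refine ⟨_, hflat, bump_restrict_compl hxx' hx'y' hy'y _, fun v hv => ?_, ?_, fun φ h1 h2 h3 => ?_⟩
  · rw [hout v hv]
    exact hμ.revenue_le v
  · set ν := bump μ x (x + l / 3) (x + l / 3 + w) (x + l) (η / M)
    have e1 := hflat.revenue_eq _ ⟨le_rfl, hx'y'.le⟩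
    have e2 := hflat.revenue_eq _ ⟨hx'y'.le, le_rfl⟩
    have hadd := measureReal_Ici_eq_add ν hx'y'.le
    have p1 : (0 : ℝ) < (x + l / 3 : ℝ≥0) := by exact_mod_cast hflat.pos
    have p2 : (0 : ℝ) < (x + l / 3 + w : ℝ≥0) := by exact_mod_cast hflat.pos.trans hx'y'
    rw [mul_comm, ← eq_div_iff p1.ne'] at e1
    rw [mul_comm, ← eq_div_iff p2.ne'] at e2
    -- On the plateau the tail at `v` is `(M + η) / v`, so its mass is a difference of two such
    -- values, at most `(M + η) * w / a ^ 2`.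
    have e3 : ν.real (Set.Ico (x + l / 3) (x + l / 3 + w)) =
        (M + η) * w / ((x + l / 3 : ℝ≥0) * (x + l / 3 + w : ℝ≥0)) := by
      rw [eq_sub_of_add_eq hadd.symm, e1, e2, div_sub_div _ _ p1.ne' p2.ne']
      push_cast
      ring
    have q1 : (a : ℝ) ≤ (x + l / 3 : ℝ≥0) := by push_cast; linarith
    have q2 : (a : ℝ) ≤ (x + l / 3 + w : ℝ≥0) := by push_cast; linarith
    rw [e3, ← mul_div_assoc, div_le_iff₀ (mul_pos p1 p2)]
    nlinarith [mul_le_mul q1 q2 haR.le p1.le]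
  · exact integral_pi_sub_le_integral_pi_withDensity μ n (measurable_bumpDensity _ _ _ _ _) h0 hbd
      hint hn φ h1 h2 h3

/-- One stage of the adversarial construction: for arbitrarily large `n`, a flat law can be raised
by `R n` on one of two halves of its flat piece, in such a way that the algorithm misses this half
with probability at least `1/4`. -/
lemma IsFlat.exists_next (R : ℕ → ℝ) (hR : ∀ n, 0 < R n)
    (hlim : Tendsto (fun n : ℕ => R n * √(n : ℝ)) atTop (𝓝 0)) (t : PricingAlgorithm)
    {μ : Measure ℝ≥0} {a b : ℝ≥0} {M : ℝ} (hμ : IsFlat μ a b M) (N : ℕ) :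
    ∃ (n : ℕ) (ν : Measure ℝ≥0) (a' b' : ℝ≥0) (H : Set ℝ≥0), N ≤ n ∧
      IsFlat ν a' b' (M + R n) ∧ Set.Ico a' b' ⊆ Set.Ico a b ∧
      ν.restrict (Set.Ico a b)ᶜ = μ.restrict (Set.Ico a b)ᶜ ∧ MeasurableSet H ∧
      Set.Ico a' b' ⊆ H ∧ (∀ v, v ∉ H → v * ν.real (Set.Ici v) ≤ M) ∧
      n * ν.real (Set.Ico a' b') ≤ 1 / 8 ∧
      1 / 4 ≤ ∫ s, (t.kernel n s).real Hᶜ ∂(Measure.pi fun _ : Fin n => ν) := by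
  have hprob := hμ.prob
  have hM := hμ.revenue_pos
  have hab : (a : ℝ) < b := by exact_mod_cast hμ.lt
  have ha : (0 : ℝ) < a := by exact_mod_cast hμ.pos
  have hb : (0 : ℝ) < b := ha.trans hab
  set l : ℝ≥0 := (b - a) / 2 with hldef
  have hlR : (l : ℝ) = (b - a) / 2 := by
    rw [hldef, NNReal.coe_div, NNReal.coe_sub hμ.lt.le]; rfl
  have hl0 : (0 : ℝ) < l := by rw [hlR]; linarith
  -- With `w ≤ l / 6` below, both slopes of the bump have width at least `l / 6`, so the density
  -- differs from `1` by at most `R n / M * K`, with `K` independent of `n`.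
  set K : ℝ := 1 + b / (l / 6) with hK
  have hK1 : 1 ≤ K := by
    have : 0 ≤ (b : ℝ) / (l / 6) := by positivity
    linarith
  have hlim2 : Tendsto (fun n : ℕ => (R n * √(n : ℝ)) ^ 2 * (K / M) ^ 2) atTop (𝓝 0) := by
    simpa using (hlim.pow 2).mul_const ((K / M) ^ 2)
  obtain ⟨n, hnN, hn0, hnε⟩ : ∃ n : ℕ, N ≤ n ∧ 0 < n ∧
      (R n * √(n : ℝ)) ^ 2 * (K / M) ^ 2 < 1 / 32 :=
    ((eventually_ge_atTop N).and ((eventually_gt_atTop 0).and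
      (hlim2.eventually (gt_mem_nhds (by norm_num))))).exists
  have hη := hR n
  have hn1 : (1 : ℝ) ≤ n := by exact_mod_cast hn0
  have hε2 : n * (R n / M * K) ^ 2 ≤ 1 / 32 := by
    refine le_trans (le_of_eq ?_) hnε.le
    rw [mul_pow (R n), Real.sq_sqrt (by linarith)]
    ring
  have hε1 : R n / M * K ≤ 1 := by
    have h0 : 0 ≤ R n / M * K := by positivity
    nlinarith
  obtain ⟨w, hw0, hwl, hwn⟩ : ∃ w : ℝ≥0, 0 < w ∧ (w : ℝ) ≤ l / 6 ∧
      n * ((M + R n) * w) ≤ (a : ℝ) ^ 2 / 8 := by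
    have hden : 0 < 8 * (n * (M + R n)) := by positivity
    have hpos : 0 < min ((l : ℝ) / 6) ((a : ℝ) ^ 2 / (8 * (n * (M + R n)))) :=
      lt_min (by positivity) (by positivity)
    refine ⟨Real.toNNReal _, Real.toNNReal_pos.2 hpos, ?_, ?_⟩ <;>
      rw [Real.coe_toNNReal _ hpos.le]
    · exact min_le_left _ _
    have h1 := min_le_right ((l : ℝ) / 6) ((a : ℝ) ^ 2 / (8 * (n * (M + R n))))
    rw [le_div_iff₀ hden] at h1
    linarith
  have hwl3 : w < l / 3 := by
    rw [← NNReal.coe_lt_coe]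
    push_cast
    linarith
  have hKb : (b : ℝ) / (l / 3 - w) ≤ K := by
    have : (b : ℝ) / (l / 3 - w) ≤ b / (l / 6) :=
      div_le_div₀ hb.le le_rfl (by positivity) (by linarith)
    linarith
  have hal : a + l + l = b := by
    rw [← NNReal.coe_inj]
    push_cast
    rw [hlR]
    ring
  have hkm : ∀ H : Set ℝ≥0, MeasurableSet H → Measurable fun s => (t.kernel n s).real H :=
    fun H hH => ((t.kernel n).measurable_coe hH).ennreal_toReal
  have hk1 : ∀ (H : Set ℝ≥0) s, (t.kernel n s).real H ≤ 1 := fun H s => by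
    have := t.isMarkovKernel n
    exact measureReal_le_one
  have main : ∀ x : ℝ≥0, a ≤ x → x + l ≤ b →
      1 / 2 ≤ ∫ s, (t.kernel n s).real (Set.Ico x (x + l))ᶜ ∂(Measure.pi fun _ : Fin n => μ) →
      ∃ (n : ℕ) (ν : Measure ℝ≥0) (a' b' : ℝ≥0) (H : Set ℝ≥0), N ≤ n ∧
      IsFlat ν a' b' (M + R n) ∧ Set.Ico a' b' ⊆ Set.Ico a b ∧
      ν.restrict (Set.Ico a b)ᶜ = μ.restrict (Set.Ico a b)ᶜ ∧ MeasurableSet H ∧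
      Set.Ico a' b' ⊆ H ∧ (∀ v, v ∉ H → v * ν.real (Set.Ici v) ≤ M) ∧
      n * ν.real (Set.Ico a' b') ≤ 1 / 8 ∧
      1 / 4 ≤ ∫ s, (t.kernel n s).real Hᶜ ∂(Measure.pi fun _ : Fin n => ν) := by
    intro x hax hxb hhalf
    obtain ⟨ν, hν, hres, hout, hmass, htest⟩ := hμ.exists_perturbation hax
      (show 0 < l by exact_mod_cast hl0) hxb hw0 hwl3 hη.le hK1 hKb hε1 hε2 hwn
    have hsub : Set.Ico (x + l / 3) (x + l / 3 + w) ⊆ Set.Ico x (x + l) := by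
      refine Set.Ico_subset_Ico (le_add_of_nonneg_right zero_le) ?_
      rw [← NNReal.coe_le_coe]
      push_cast
      linarith
    have hsub2 : Set.Ico x (x + l) ⊆ Set.Ico a b := Set.Ico_subset_Ico hax hxb
    refine ⟨n, ν, _, _, Set.Ico x (x + l), hnN, hν, hsub.trans hsub2, ?_, measurableSet_Ico,
      hsub, hout, hmass, ?_⟩
    · have h1 := congrArg (fun m => Measure.restrict m (Set.Ico a b)ᶜ) hres
      simpa only [Measure.restrict_restrict_of_subset (Set.compl_subset_compl.2 hsub2)] using h1
    · have := htest (fun s => (t.kernel n s).real (Set.Ico x (x + l))ᶜ)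
        (hkm _ measurableSet_Ico.compl) (fun s => measureReal_nonneg) (hk1 _)
      linarith
  -- The two halves are disjoint, so the probabilities of missing them add up to at least `1`, and
  -- one of them is at least `1/2`.
  by_cases hleft : 1 / 2 ≤ ∫ s, (t.kernel n s).real (Set.Ico a (a + l))ᶜ
      ∂(Measure.pi fun _ : Fin n => μ)
  · exact main a le_rfl (by rw [← hal]; exact le_add_of_nonneg_right zero_le) hleft
  · refine main (a + l) (le_add_of_nonneg_right zero_le) hal.le ?_
    have hint : ∀ H : Set ℝ≥0, MeasurableSet H →
        Integrable (fun s => (t.kernel n s).real H) (Measure.pi fun _ : Fin n => μ) :=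
      fun H hH => Integrable.of_bound (hkm H hH).aestronglyMeasurable 1
        (Eventually.of_forall fun s => by
          rw [Real.norm_eq_abs, abs_of_nonneg measureReal_nonneg]; exact hk1 H s)
    have hsum : (1 : ℝ) ≤ ∫ s, ((t.kernel n s).real (Set.Ico a (a + l))ᶜ +
        (t.kernel n s).real (Set.Ico (a + l) (a + l + l))ᶜ) ∂(Measure.pi fun _ : Fin n => μ) := by
      have h1 : ∫ _s, (1 : ℝ) ∂(Measure.pi fun _ : Fin n => μ) = 1 := by simp
      rw [← h1]
      refine integral_mono (integrable_const _)
        ((hint _ measurableSet_Ico.compl).add (hint _ measurableSet_Ico.compl)) fun s => ?_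
      have := t.isMarkovKernel n
      have hu : (Set.Ico a (a + l))ᶜ ∪ (Set.Ico (a + l) (a + l + l))ᶜ = Set.univ := by
        rw [← Set.compl_inter, Set.compl_univ_iff, Set.Ico_inter_Ico]
        refine Set.Ico_eq_empty ?_
        simp
      have h2 := measureReal_union_le (μ := t.kernel n s) (Set.Ico a (a + l))ᶜ
        (Set.Ico (a + l) (a + l + l))ᶜ
      rw [hu, probReal_univ] at h2
      exact h2
    rw [integral_add (hint _ measurableSet_Ico.compl) (hint _ measurableSet_Ico.compl)] at hsum
    linarith

/-! ### Limit law and stability of earlier stages -/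

/-- A sequence of laws of which each modifies its predecessor only on the members of a decreasing
sequence of sets with vanishing mass has a limit law. -/
lemma exists_limit_measure {X : Type*} [MeasurableSpace X] (μ : ℕ → Measure X)
    [∀ k, IsProbabilityMeasure (μ k)] (E : ℕ → Set X) (hE : ∀ k, MeasurableSet (E k))
    (hanti : Antitone E) (hres : ∀ k, (μ (k + 1)).restrict (E k)ᶜ = (μ k).restrict (E k)ᶜ)
    (hlim : Tendsto (fun k => μ k (E k)) atTop (𝓝 0)) :
    ∃ ν : Measure X, IsProbabilityMeasure ν ∧
      (∀ k, ν.restrict (E k)ᶜ = (μ k).restrict (E k)ᶜ) ∧ ∀ S, (∀ k, μ k S = 0) → ν S = 0 := by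
  set A : ℕ → Set X := fun k => (E k)ᶜ with hA
  have hAm : ∀ k, MeasurableSet (A k) := fun k => (hE k).compl
  have hmono : Monotone A := fun i j hij => Set.compl_subset_compl.2 (hanti hij)
  have hdm : ∀ k, MeasurableSet (disjointed A k) := fun k => .disjointed hAm k
  have hstab : ∀ j k, j ≤ k → (μ k).restrict (A j) = (μ j).restrict (A j) := by
    intro j k hjk
    induction k, hjk using Nat.le_induction with
    | base => rfl
    | succ k hjk ih =>
      rw [← ih]
      have h1 := congrArg (fun m => Measure.restrict m (A j)) (hres k)
      have hsub : A j ⊆ (E k)ᶜ := hmono hjk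
      simpa only [Measure.restrict_restrict_of_subset hsub] using h1
  -- Off `E k` the laws are constant from stage `k` on, so `ν` takes on each newly frozen region its
  -- final value. No mass is lost because `μ k (E k)` tends to `0`.
  set ν := Measure.sum fun k => (μ k).restrict (disjointed A k) with hν
  have happ : ∀ k S, MeasurableSet S → S ⊆ A k → ν S = μ k S := by
    intro k S hS hSk
    have h1 : ∀ j, ((μ j).restrict (disjointed A j)) S = μ k (S ∩ disjointed A j) := by
      intro j
      rw [Measure.restrict_apply hS]
      rcases le_or_gt j k with hjk | hjk
      · have h2 := congrArg (fun m => m (S ∩ disjointed A j)) (hstab j k hjk)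
        have h3 : S ∩ disjointed A j ⊆ A j := fun z hz => disjointed_subset A j hz.2
        simpa only [Measure.restrict_eq_self _ h3] using h2.symm
      · have h2 : S ∩ disjointed A j = ∅ := by
          rw [← Set.disjoint_iff_inter_eq_empty]
          refine Set.disjoint_left.2 fun z hz hz' => ?_
          rw [disjointed_apply] at hz'
          exact hz'.2 (Finset.le_sup (f := A) (Finset.mem_Iio.2 hjk) (hSk hz))
        rw [h2, measure_empty, measure_empty]
    rw [hν, Measure.sum_apply _ hS]
    simp only [h1]
    rw [← measure_iUnion]
    · rw [← Set.inter_iUnion, iUnion_disjointed, Set.inter_eq_left.2]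
      exact hSk.trans (Set.subset_iUnion A k)
    · intro i j hij
      exact (disjoint_disjointed A hij).mono Set.inter_subset_right Set.inter_subset_right
    · exact fun j => hS.inter (hdm j)
  refine ⟨ν, ⟨?_⟩, fun k => ?_, fun S hS => ?_⟩
  · have h1 : ν Set.univ = ν (⋃ k, A k) := by
      rw [← measure_add_measure_compl (MeasurableSet.iUnion hAm)]
      have h0 : ν (⋃ k, A k)ᶜ = 0 := by
        rw [hν, Measure.sum_apply _ (MeasurableSet.iUnion hAm).compl, ENNReal.tsum_eq_zero]
        intro k
        rw [Measure.restrict_apply (MeasurableSet.iUnion hAm).compl]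
        have : (⋃ k, A k)ᶜ ∩ disjointed A k = ∅ := by
          rw [← Set.disjoint_iff_inter_eq_empty, Set.disjoint_compl_left_iff_subset]
          exact (disjointed_subset A k).trans (Set.subset_iUnion A k)
        rw [this, measure_empty]
      rw [h0, add_zero]
    rw [h1]
    refine tendsto_nhds_unique (tendsto_measure_iUnion_atTop hmono) ?_
    have h2 : (ν ∘ A) = fun k => 1 - μ k (E k) := by
      ext k
      rw [Function.comp_apply, happ k _ (hAm k) le_rfl, hA, prob_compl_eq_one_sub (hE k)]
    rw [h2]
    simpa using ENNReal.Tendsto.sub tendsto_const_nhds hlim (Or.inl ENNReal.one_ne_top)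
  · ext S hS
    rw [Measure.restrict_apply hS, Measure.restrict_apply hS,
      happ k _ (hS.inter (hAm k)) Set.inter_subset_right]
  · rw [hν, Measure.sum_apply_eq_zero]
    exact fun k => le_antisymm ((Measure.restrict_apply_le _ _).trans (hS k).le) zero_le

/-- Two laws that agree off `[a, b)` have the same tails off `[a, b)`. -/
lemma measureReal_Ici_eq_of_restrict_eq (μ ν : Measure ℝ≥0) [IsProbabilityMeasure μ]
    [IsProbabilityMeasure ν] {a b : ℝ≥0}
    (h : ν.restrict (Set.Ico a b)ᶜ = μ.restrict (Set.Ico a b)ᶜ) {v : ℝ≥0} (hv : v ∉ Set.Ico a b) :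
    ν.real (Set.Ici v) = μ.real (Set.Ici v) := by
  have happ : ∀ S, S ⊆ (Set.Ico a b)ᶜ → ν.real S = μ.real S := by
    intro S hS
    have h2 := congrArg (fun m => m S) h
    simp only [Measure.restrict_eq_self _ hS] at h2
    rw [measureReal_def, measureReal_def, h2]
  rcases lt_or_ge v a with hva | hva
  -- Here `[v, ∞)` contains `[a, b)`, so the comparison is made on the complement, using that both
  -- masses are `1`.
  · have h1 := happ (Set.Iio v) fun z hz hz' => absurd (lt_of_lt_of_le hz hva.le) (not_lt.2 hz'.1)
    rw [← Set.compl_Iio, probReal_compl_eq_one_sub measurableSet_Iio,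
      probReal_compl_eq_one_sub measurableSet_Iio, h1]
  · have hb : b ≤ v := not_lt.1 fun h' => hv ⟨hva, h'⟩
    exact happ _ fun z hz hz' => absurd (lt_of_lt_of_le hz'.2 hb) (not_lt.2 hz)

/-- A set that is unlikely to meet the sample does not influence a test by more than the expected
number of sample points in it. -/
lemma integral_pi_sub_le_of_restrict_eq {X : Type*} [MeasurableSpace X] (μ ν : Measure X)
    [IsProbabilityMeasure μ] [IsProbabilityMeasure ν] {E : Set X} (hE : MeasurableSet E)
    (h : ν.restrict Eᶜ = μ.restrict Eᶜ) (n : ℕ) (φ : (Fin n → X) → ℝ) (hφ : Measurable φ)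
    (hφ0 : ∀ s, 0 ≤ φ s) (hφ1 : ∀ s, φ s ≤ 1) :
    ∫ s, φ s ∂(Measure.pi fun _ => μ) - n * μ.real E ≤ ∫ s, φ s ∂(Measure.pi fun _ => ν) := by
  -- On `G` no sample point falls in `E` and the two product laws coincide; a union bound controls
  -- `Gᶜ`.
  set G : Set (Fin n → X) := Set.univ.pi fun _ => Eᶜ with hG
  have hGm : MeasurableSet G := MeasurableSet.univ_pi fun _ => hE.compl
  have hint : ∀ P : Measure (Fin n → X), IsFiniteMeasure P → Integrable φ P := fun P _ =>
    Integrable.of_bound hφ.aestronglyMeasurable 1 (Eventually.of_forall fun s => by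
      rw [Real.norm_eq_abs, abs_of_nonneg (hφ0 s)]; exact hφ1 s)
  have h1 : ∫ s in G, φ s ∂(Measure.pi fun _ => ν) = ∫ s in G, φ s ∂(Measure.pi fun _ => μ) := by
    rw [hG, Measure.restrict_pi_pi, Measure.restrict_pi_pi, h]
  have h2 : ∫ s in G, φ s ∂(Measure.pi fun _ => ν) ≤ ∫ s, φ s ∂(Measure.pi fun _ => ν) :=
    setIntegral_le_integral (hint _ inferInstance) (Eventually.of_forall hφ0)
  have h3 := integral_add_compl hGm (hint (Measure.pi fun _ => μ) inferInstance)
  have h4 : ∫ s in Gᶜ, φ s ∂(Measure.pi fun _ => μ) ≤ n * μ.real E := by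
    calc ∫ s in Gᶜ, φ s ∂(Measure.pi fun _ => μ)
        ≤ ∫ _s in Gᶜ, (1 : ℝ) ∂(Measure.pi fun _ => μ) :=
          integral_mono (hint _ inferInstance) (integrable_const _) hφ1
      _ = (Measure.pi fun _ : Fin n => μ).real Gᶜ := by simp
      _ ≤ (Measure.pi fun _ : Fin n => μ).real (⋃ i, Function.eval i ⁻¹' E) := by
          refine measureReal_mono fun s hs => ?_
          simpa [hG, Set.mem_pi] using hs
      _ ≤ ∑ i : Fin n, (Measure.pi fun _ : Fin n => μ).real (Function.eval i ⁻¹' E) :=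
          measureReal_iUnion_fintype_le _
      _ = n * μ.real E := by
          have : ∀ i : Fin n, (Measure.pi fun _ : Fin n => μ).real (Function.eval i ⁻¹' E) =
              μ.real E := fun i => by
            rw [measureReal_def, (measurePreserving_eval (fun _ : Fin n => μ) i).measure_preimage
              hE.nullMeasurableSet, measureReal_def]
          simp [this]
  linarith

/-! ### Attainment, the initial flat law and the gap bound -/

lemma revenue_eq_ofReal (μ : Measure ℝ≥0) [IsProbabilityMeasure μ] (p : ℝ≥0) :
    revenue μ p = ENNReal.ofReal (p * μ.real (Set.Ici p)) := by
  rw [ENNReal.ofReal_mul p.coe_nonneg, ofReal_measureReal, ENNReal.ofReal_coe_nnreal, revenue]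

/-- A law on `[0, 1]` has an optimal price. -/
lemma mem_attainedClass_of_supp (D : ValuationDistribution)
    (hD : (D : Measure ℝ≥0) (Set.Icc 0 1)ᶜ = 0) : D ∈ attainedClass := by
  set f : ℝ≥0 → ℝ := fun p => p * (D : Measure ℝ≥0).real (Set.Ici p) with hf
  have hrev : ∀ p, revenue (D : Measure ℝ≥0) p = ENNReal.ofReal (f p) := revenue_eq_ofReal _
  -- From the left the tail is continuous; from the right it can only drop. Upper semicontinuity
  -- suffices for a maximum on the compact interval.
  have husc : UpperSemicontinuousOn f (Set.Icc 0 1) := by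
    refine UpperSemicontinuous.upperSemicontinuousOn (fun p y hy => ?_) _
    rw [← nhdsLE_sup_nhdsGE, eventually_sup]
    constructor
    · have hc : Tendsto (fun q : ℝ≥0 => (q : ℝ)) (𝓝[≤] p) (𝓝 p) :=
        (NNReal.continuous_coe.tendsto p).mono_left nhdsWithin_le_nhds
      exact (hc.mul (tendsto_measureReal_Ici (D : Measure ℝ≥0) p)).eventually (gt_mem_nhds hy)
    · have hc : Tendsto (fun q : ℝ≥0 => (q : ℝ) * (D : Measure ℝ≥0).real (Set.Ici p)) (𝓝[≥] p)
          (𝓝 (p * (D : Measure ℝ≥0).real (Set.Ici p))) :=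
        ((NNReal.continuous_coe.tendsto p).mul_const _).mono_left nhdsWithin_le_nhds
      filter_upwards [hc.eventually (gt_mem_nhds hy), self_mem_nhdsWithin] with q hq hpq
      refine lt_of_le_of_lt ?_ hq
      exact mul_le_mul_of_nonneg_left (measureReal_mono (Set.Ici_subset_Ici.2 hpq)) q.2
  obtain ⟨p, hp, hmax⟩ := husc.exists_isMaxOn ⟨0, by simp⟩ isCompact_Icc
  have hopt : optRevenue D = revenue (D : Measure ℝ≥0) p := by
    refine le_antisymm (iSup_le fun q => ?_) (le_iSup (revenue (D : Measure ℝ≥0)) p)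
    by_cases hq : q ≤ 1
    · rw [hrev, hrev]
      exact ENNReal.ofReal_le_ofReal (hmax ⟨zero_le, hq⟩)
    · have hsub : Set.Ici q ⊆ (Set.Icc (0 : ℝ≥0) 1)ᶜ := fun z hz hz' => hq (le_trans hz hz'.2)
      have h0 : (D : Measure ℝ≥0) (Set.Ici q) = 0 := measure_mono_null hsub hD
      simp [revenue, h0]
  exact ⟨by rw [hopt, hrev]; exact ENNReal.ofReal_lt_top, p, hopt.symm⟩

/-- The equal-revenue law on `[1/2, 1]`. -/
lemma exists_isFlat : ∃ μ : Measure ℝ≥0, IsFlat μ (1 / 2) 1 (1 / 2) := by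
  set P : Measure ℝ := volume.restrict (Set.Ioc 0 1) with hP
  have hPprob : IsProbabilityMeasure P := ⟨by simp [hP]⟩
  -- Inverse transform sampling: for uniform `u`, `f u ≥ v` has probability `1 / (2 * v)` for `v` in
  -- `[1/2, 1]`, with an atom at `1`.
  set f : ℝ → ℝ≥0 := fun u => (min 1 (max (1 / 2) (1 / (2 * u)))).toNNReal with hf
  have hfm : Measurable f :=
    (measurable_const.min (measurable_const.max
      (measurable_const.div (measurable_const.mul measurable_id)))).real_toNNReal
  have hprob : IsProbabilityMeasure (P.map f) :=
    Measure.isProbabilityMeasure_map hfm.aemeasurable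
  have hfle : ∀ u, f u ≤ 1 := fun u => by
    rw [hf, Real.toNNReal_le_one]; exact min_le_left _ _
  have hfeq : ∀ v ∈ Set.Icc (1 / 2 : ℝ≥0) 1, (v : ℝ) * (P.map f).real (Set.Ici v) = 1 / 2 := by
    intro v hv
    have hv1 : (1 / 2 : ℝ) ≤ v := by exact_mod_cast hv.1
    have hv2 : (v : ℝ) ≤ 1 := by exact_mod_cast hv.2
    have hv0 : (0 : ℝ) < v := by linarith
    have hset : f ⁻¹' Set.Ici v ∩ Set.Ioc 0 1 = Set.Ioc 0 (1 / (2 * (v : ℝ))) := by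
      ext u
      simp only [Set.mem_inter_iff, Set.mem_preimage, Set.mem_Ici, Set.mem_Ioc, hf,
        Real.le_toNNReal_iff_coe_le' (show 0 < v from hv0), le_min_iff, le_max_iff]
      constructor
      · rintro ⟨⟨-, h | h⟩, h0, h1⟩
        · have : (v : ℝ) = 1 / 2 := le_antisymm h hv1
          refine ⟨h0, ?_⟩
          rw [this]
          simpa using h1
        · refine ⟨h0, ?_⟩
          rw [le_div_iff₀ (by positivity)] at h ⊢
          linarith
      · rintro ⟨h0, h⟩
        have h' := h
        rw [le_div_iff₀ (by positivity)] at h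
        refine ⟨⟨hv2, Or.inr ?_⟩, h0, h'.trans ?_⟩
        · rw [le_div_iff₀ (by positivity)]
          linarith
        · rw [div_le_one (by positivity)]
          linarith
    have hm : (P.map f).real (Set.Ici v) = 1 / (2 * v) := by
      rw [measureReal_def, Measure.map_apply hfm measurableSet_Ici, hP,
        Measure.restrict_apply (hfm measurableSet_Ici), hset, Real.volume_Ioc, sub_zero,
        ENNReal.toReal_ofReal (by positivity)]
    rw [hm]
    field_simp
  have hsupp : (P.map f) (Set.Icc 0 1)ᶜ = 0 := by
    rw [Measure.map_apply hfm measurableSet_Icc.compl]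
    have : f ⁻¹' (Set.Icc 0 1)ᶜ = ∅ :=
      Set.eq_empty_of_forall_notMem fun u hu => hu ⟨zero_le, hfle u⟩
    rw [this, measure_empty]
  refine ⟨P.map f, hprob, hsupp, by norm_num, ?_, by norm_num, fun v => ?_, hfeq⟩
  · rw [← NNReal.coe_lt_coe]
    norm_num
  · rcases le_total v (1 / 2) with h | h
    · have h1 : (v : ℝ) ≤ 1 / 2 := by exact_mod_cast h
      have h2 : (P.map f).real (Set.Ici v) ≤ 1 := measureReal_le_one
      nlinarith [v.2]
    · rcases le_or_gt v 1 with h' | h'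
      · exact (hfeq v ⟨h, h'⟩).le
      · have hsub : Set.Ici v ⊆ (Set.Icc (0 : ℝ≥0) 1)ᶜ :=
          fun z hz hz' => absurd (le_trans hz hz'.2) (not_le.2 h')
        have h0 : (P.map f) (Set.Ici v) = 0 := measure_mono_null hsub hsupp
        rw [measureReal_def, h0]
        norm_num

/-- A gap bound from an event on which the price is suboptimal by `δ`. -/
lemma mul_le_revenueGap (t : PricingAlgorithm) (D : ValuationDistribution) (hD : D ∈ attainedClass)
    (n : ℕ) (H : Set ℝ≥0) (hH : MeasurableSet H) {δ θ : ℝ} (hδ : 0 ≤ δ) (hθ : 0 ≤ θ)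
    (hrev : ∀ p, p ∉ H → revenue (D : Measure ℝ≥0) p + ENNReal.ofReal δ ≤ optRevenue D)
    (hprob : θ ≤ ∫ s, (t.kernel n s).real Hᶜ
      ∂(Measure.pi fun _ : Fin n => (D : Measure ℝ≥0))) :
    δ * θ ≤ revenueGap t D n := by
  have := t.isMarkovKernel n
  have hkm : Measurable fun s => t.kernel n s Hᶜ := (t.kernel n).measurable_coe hH.compl
  have h1 : ENNReal.ofReal θ ≤ ∫⁻ s, t.kernel n s Hᶜ
      ∂(Measure.pi fun _ : Fin n => (D : Measure ℝ≥0)) := by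
    refine (ENNReal.ofReal_le_ofReal hprob).trans (le_of_eq ?_)
    rw [ofReal_integral_eq_lintegral_ofReal]
    · exact lintegral_congr fun s => ofReal_measureReal
    · exact Integrable.of_bound hkm.ennreal_toReal.aestronglyMeasurable 1
        (Eventually.of_forall fun s => by
          rw [Real.norm_eq_abs, abs_of_nonneg measureReal_nonneg]
          exact measureReal_le_one)
    · exact Eventually.of_forall fun s => measureReal_nonneg
  have h2 : expectedRevenue t D n + ENNReal.ofReal δ * ENNReal.ofReal θ ≤ optRevenue D := by
    calc expectedRevenue t D n + ENNReal.ofReal δ * ENNReal.ofReal θ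
        ≤ expectedRevenue t D n + ENNReal.ofReal δ * ∫⁻ s, t.kernel n s Hᶜ
            ∂(Measure.pi fun _ : Fin n => (D : Measure ℝ≥0)) := by gcongr
      _ = ∫⁻ s, ((∫⁻ p, revenue (D : Measure ℝ≥0) p ∂(t.kernel n s)) +
            ENNReal.ofReal δ * t.kernel n s Hᶜ)
            ∂(Measure.pi fun _ : Fin n => (D : Measure ℝ≥0)) := by
          rw [lintegral_add_right _ (hkm.const_mul _), lintegral_const_mul _ hkm, expectedRevenue]
      _ ≤ ∫⁻ _s, optRevenue D ∂(Measure.pi fun _ : Fin n => (D : Measure ℝ≥0)) := by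
          refine lintegral_mono fun s => ?_
          have hi : ENNReal.ofReal δ * t.kernel n s Hᶜ =
              ∫⁻ p, Hᶜ.indicator (fun _ => ENNReal.ofReal δ) p ∂(t.kernel n s) := by
            rw [lintegral_indicator_const hH.compl]
          dsimp only
          rw [hi, ← lintegral_add_right _ (measurable_const.indicator hH.compl)]
          calc _ ≤ ∫⁻ _p, optRevenue D ∂(t.kernel n s) := by
                refine lintegral_mono fun p => ?_
                by_cases hp : p ∈ H
                · rw [Set.indicator_of_notMem (Set.notMem_compl_iff.2 hp), add_zero]
                  exact le_iSup (revenue (D : Measure ℝ≥0)) p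
                · simpa [hp] using hrev p hp
            _ = optRevenue D := by simp
      _ = optRevenue D := by simp
  have hfin : optRevenue D ≠ ∞ := hD.1.ne
  have h3 := ENNReal.toReal_mono hfin h2
  have h4 : expectedRevenue t D n ≠ ∞ := ne_top_of_le_ne_top hfin (le_self_add.trans h2)
  rw [← ENNReal.ofReal_mul hδ, ENNReal.toReal_add h4 ENNReal.ofReal_ne_top,
    ENNReal.toReal_ofReal (by positivity)] at h3
  unfold revenueGap
  linarith

/-! ### Iterating the stages: one law hard at infinitely many sample sizes -/

/-- A stage of the adversarial construction. -/
structure FlatStage where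
  size : ℕ
  law : Measure ℝ≥0
  left : ℝ≥0
  right : ℝ≥0
  value : ℝ
  isFlat : IsFlat law left right value

/-- The relation between consecutive stages of the adversarial construction. -/
structure FlatStage.Extends (R : ℕ → ℝ) (t : PricingAlgorithm) (S S' : FlatStage) (H : Set ℝ≥0) :
    Prop where
  size_lt : S.size < S'.size
  value_eq : S'.value = S.value + R S'.size
  subset : Set.Ico S'.left S'.right ⊆ Set.Ico S.left S.right
  restrict_eq : S'.law.restrict (Set.Ico S.left S.right)ᶜ =
    S.law.restrict (Set.Ico S.left S.right)ᶜ
  measurableSet : MeasurableSet H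
  subset_good : Set.Ico S'.left S'.right ⊆ H
  revenue_le : ∀ v, v ∉ H → v * S'.law.real (Set.Ici v) ≤ S.value
  mass_le : S'.size * S'.law.real (Set.Ico S'.left S'.right) ≤ 1 / 8
  miss : 1 / 4 ≤ ∫ s, (t.kernel S'.size s).real Hᶜ ∂(Measure.pi fun _ : Fin S'.size => S'.law)

/-- The gap of an algorithm is infinitely often at least a constant times a rate in `o(n^{-1/2})`,
for one law on `[0, 1]`. -/
theorem notUniversallyLearnableFasterThan_of_tendsto (R : ℕ → ℝ) (hR : ∀ n, 0 < R n)
    (hlim : Tendsto (fun n : ℕ => R n * √(n : ℝ)) atTop (𝓝 0)) :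
    NotUniversallyLearnableFasterThan
      {D | D ∈ attainedClass ∧ (D : Measure ℝ≥0) (Set.Icc 0 1) = 1} R := by
  intro t
  have hstep : ∀ S : FlatStage, ∃ (S' : FlatStage) (H : Set ℝ≥0), S.Extends R t S' H := by
    intro S
    obtain ⟨n, ν, a', b', H, h1, h3, h4, h5, h6, h7, h8, h9, h10⟩ :=
      S.isFlat.exists_next R hR hlim t (S.size + 1)
    exact ⟨⟨n, ν, a', b', _, h3⟩, H, h1, rfl, h4, h5, h6, h7, h8, h9, h10⟩
  choose next good hnext using hstep
  obtain ⟨μ₀, hμ₀⟩ := exists_isFlat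
  set S : ℕ → FlatStage := fun k => next^[k] ⟨0, μ₀, _, _, _, hμ₀⟩ with hS
  have hext : ∀ k, (S k).Extends R t (S (k + 1)) (good (S k)) := fun k => by
    have := hnext (S k)
    rwa [show next (S k) = S (k + 1) by rw [hS]; exact (Function.iterate_succ_apply' _ _ _).symm]
      at this
  have hprob : ∀ k, IsProbabilityMeasure (S k).law := fun k => (S k).isFlat.prob
  have hsize : StrictMono fun k => (S k).size := strictMono_nat_of_lt_succ fun k => (hext k).size_lt
  have hmass : Tendsto (fun k => (S k).law (Set.Ico (S k).left (S k).right)) atTop (𝓝 0) := by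
    rw [← tendsto_add_atTop_iff_nat 1]
    -- The plateau mass is at most `1 / (8 * size)`, and the sizes are strictly increasing, so the
    -- size at stage `k + 1` is at least `k + 1`.
    have hle : ∀ k : ℕ, (S (k + 1)).law (Set.Ico (S (k + 1)).left (S (k + 1)).right) ≤
        ENNReal.ofReal (1 / ((k : ℝ) + 1)) := fun k => by
      rw [← ofReal_measureReal]
      refine ENNReal.ofReal_le_ofReal ?_
      rw [le_div_iff₀ (by positivity)]
      have h1 := (hext k).mass_le
      have h2 : ((k + 1 : ℕ) : ℝ) ≤ (S (k + 1)).size := by exact_mod_cast hsize.le_apply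
      push_cast at h2
      have h3 := measureReal_nonneg (μ := (S (k + 1)).law)
        (s := Set.Ico (S (k + 1)).left (S (k + 1)).right)
      nlinarith
    refine tendsto_of_tendsto_of_tendsto_of_le_of_le tendsto_const_nhds ?_ (fun k => zero_le) hle
    have := ENNReal.tendsto_ofReal (tendsto_one_div_add_atTop_nhds_zero_nat (𝕜 := ℝ))
    rwa [ENNReal.ofReal_zero] at this
  obtain ⟨ν, hν, hres, hzero⟩ := exists_limit_measure (fun k => (S k).law)
    (fun k => Set.Ico (S k).left (S k).right) (fun k => measurableSet_Ico)
    (antitone_nat_of_succ_le fun k => (hext k).subset) (fun k => (hext k).restrict_eq) hmass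
  have hsupp : ν (Set.Icc 0 1)ᶜ = 0 := hzero _ fun k => (S k).isFlat.supp
  set D : ValuationDistribution := ⟨ν, hν⟩ with hDdef
  have hDν : (D : Measure ℝ≥0) = ν := rfl
  have hD : D ∈ attainedClass := mem_attainedClass_of_supp D hsupp
  refine ⟨D, ⟨hD, ?_⟩, 1 / 8, by norm_num, 1, one_pos, ?_⟩
  · rw [hDν]
    exact (prob_compl_eq_zero_iff measurableSet_Icc).1 hsupp
  have hgap : ∀ k, 1 / 8 * R (S (k + 1)).size ≤ revenueGap t D (S (k + 1)).size := by
    intro k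
    have hflat := (S (k + 1)).isFlat
    have hx := hext k
    have htail : ∀ v, v ∉ Set.Ico (S (k + 1)).left (S (k + 1)).right →
        ν.real (Set.Ici v) = (S (k + 1)).law.real (Set.Ici v) := fun v hv =>
      measureReal_Ici_eq_of_restrict_eq _ _ (hres (k + 1)) hv
    -- The right endpoint lies outside the half-open interval that later stages modify, yet still on
    -- the plateau, so its revenue survives in the limit.
    have hopt : ENNReal.ofReal (S (k + 1)).value ≤ optRevenue D := by
      refine le_trans (le_of_eq ?_) (le_iSup (revenue (D : Measure ℝ≥0)) (S (k + 1)).right)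
      rw [hDν, revenue_eq_ofReal, htail _ (by simp),
        hflat.revenue_eq _ ⟨hflat.lt.le, le_rfl⟩]
    rw [mul_comm]
    refine mul_le_revenueGap t D hD _ (good (S k)) hx.measurableSet (hR _).le (by norm_num)
      (fun p hp => ?_) ?_
    · refine le_trans ?_ hopt
      rw [hDν, revenue_eq_ofReal, htail p fun h => hp (hx.subset_good h),
        ← ENNReal.ofReal_add (by positivity) (hR _).le, hx.value_eq]
      exact ENNReal.ofReal_le_ofReal (add_le_add_left (hx.revenue_le p hp) _)
    -- The miss probability `1/4` under the stage law loses at most the expected number `1/8` of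
    -- sample points in the plateau, which leaves `1/8` under `ν`.
    · have h1 := integral_pi_sub_le_of_restrict_eq (S (k + 1)).law ν measurableSet_Ico
        (hres (k + 1)) (S (k + 1)).size (fun s => (t.kernel _ s).real (good (S k))ᶜ)
        ((t.kernel _).measurable_coe hx.measurableSet.compl).ennreal_toReal
        (fun s => measureReal_nonneg) (fun s => by
          have := t.isMarkovKernel (S (k + 1)).size
          exact measureReal_le_one)
      have h2 := hx.miss
      have h3 := hx.mass_le
      rw [hDν]
      linarith
  refine frequently_atTop.2 fun N => ⟨(S (N + 1)).size, ?_, ?_⟩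
  · exact (Nat.le_succ N).trans hsize.le_apply
  · rw [one_mul, Nat.floor_natCast]
    exact hgap N

theorem mainTheorem1 :
    (∀ R : ℕ → ℝ, (∀ n, 0 < R n) →
      Tendsto (fun n : ℕ => R n * Real.sqrt (n : ℝ)) atTop atTop →
      ∃ g : ℕ → ℕ, Monotone g ∧ Tendsto g atTop atTop ∧
        (∀ᶠ n : ℕ in atTop, (g n : ℝ) / Real.sqrt (n : ℝ) ≤ R n) ∧
        (∃ t : PricingAlgorithm, IsCappedERM g t) ∧
        ∀ t : PricingAlgorithm, IsCappedERM g t →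
          LearnsUniversallyAtRate t attainedClass R) ∧
    (∀ R : ℕ → ℝ, (∀ n, 0 < R n) →
      Tendsto (fun n : ℕ => R n * Real.sqrt (n : ℝ)) atTop (𝓝 0) →
      NotUniversallyLearnableFasterThan
        {D | D ∈ attainedClass ∧ (D : Measure ℝ≥0) (Set.Icc 0 1) = 1} R) := by
  refine ⟨fun R hR hlim => ?_, notUniversallyLearnableFasterThan_of_tendsto⟩
  obtain ⟨g, hmono, htop, hle⟩ := exists_cap R hR hlim
  exact ⟨g, hmono, htop, hle, exists_isCappedERM g,
    learnsUniversally_of_isCappedERM R hR g htop hle⟩
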